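/- Let $M$ be a smooth finite-dimensional Hausdorff manifold without boundary, $d\ge 0$, $\kappa\ge 1$ integers and $T>0$. Let $T(\mathbb R^d)=\bigoplus_{k\ge 0}(\mathbb R^d)^{\otimes k}$ be the tensor algebra with commutator $[A,B]_\otimes=A\otimes B-B\otimes A$, and let $\pi_{\le\kappa}$, $\pi_{>\kappa}=I-\pi_{\le\kappa}$ be the projections onto the components of degree $\le\kappa$ and $>\kappa$. The truncated tensor algebra $T^{(\kappa)}(\mathbb R^d)=\bigoplus_{k\le\kappa}(\mathbb R^d)^{\otimes k}$ has the product $AB=\pi_{\le\kappa}(A\otimes B)$ and the bracket $[A,B]=AB-BA=\pi_{\le\kappa}[A,B]_\otimes$; put $\operatorname{ad}_AB=[A,B]$. Let $F^{(\kappa)}(\mathbb R^d)$ be the Lie subalgebra of $(T^{(\kappa)}(\mathbb R^d),[\cdot,\cdot])$ generated by $\mathbb R^d$. For $A\in F^{(\kappa)}(\mathbb R^d)$ put $e^A=\sum_{k=0}^{\kappa}A^k/k!$ (powers in $T^{(\kappa)}(\mathbb R^d)$) and $\operatorname{Ad}_{e^{A}}B=e^{A}Be^{-A}$. Let $\psi(z)=(e^z-1)/z=\sum_{k\ge0}z^k/(k+1)!$;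 since $\operatorname{ad}_A$ is nilpotent, $\psi(c\operatorname{ad}_A)=\sum_{k=0}^{\kappa-1}\frac{c^k}{(k+1)!}\operatorname{ad}_A^k$ for $c\in\mathbb R$. Let $V:\mathbb R^d\to\Gamma(TM)$ be a linear map into the smooth vector fields on $M$ (a dynamical system). Viewing vector fields as operators on $C^\infty(M,\mathbb R)$, extend $V$ to an algebra homomorphism on $T(\mathbb R^d)$, still written $A\mapsto V_A$; for $A$ in the free Lie algebra $F(\mathbb R^d)\subset T(\mathbb R^d)$ generated by $\mathbb R^d$ under $[\cdot,\cdot]_\otimes$ (which contains $F^{(\kappa)}(\mathbb R^d)$), $V_A$ is a vector field. Suppose that $V$ is $\kappa$-complete: for every $\xi\in C^1([0,T],F^{(\kappa)}(\mathbb R^d))$, $s\in[0,T]$ and $m\in M$ there is a solution $\sigma:[0,T]\to M$ of $\dot\sigma(t)=V_{\dot\xi(t)}(\sigma(t))$, $\sigma(s)=m$. Then, for every $A\in F^{(\kappa)}(\mathbb R^d)$, the vector field $V_A$ is complete. Writing $e^{sV_A}$ for its flow and $\operatorname{Ad}_{e^{sV_A}}Y=(e^{sV_A})_*\,Y\circ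 e^{-sV_A}$, one has, for all $A,B\in F^{(\kappa)}(\mathbb R^d)$, $$\int_0^1\operatorname{Ad}_{e^{sV_A}}V_B\,ds =V_{\left[\int_0^1\operatorname{Ad}_{e^{-sA}}B\,ds\right]}+\int_0^1\operatorname{Ad}_{e^{sV_A}}V_{\pi_{>\kappa}[A,\psi((s-1)\operatorname{ad}_A)B]_\otimes}\,(s-1)\,ds$$ $$\phantom{\int_0^1\operatorname{Ad}_{e^{sV_A}}V_B\,ds} =V_{\psi(-\operatorname{ad}_A)B}+\int_0^1\operatorname{Ad}_{e^{sV_A}}V_{\pi_{>\kappa}[A,\psi((s-1)\operatorname{ad}_A)B]_\otimes}\,(s-1)\,ds .$$ Here the integrals of vector fields are taken pointwise in $T_mM$, $m\in M$, and their integrands are integrable over $[0,1]$; moreover $\int_0^1\operatorname{Ad}_{e^{-sA}}B\,ds\in F^{(\kappa)}(\mathbb R^d)$. -/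

import Mathlib

open scoped Manifold ContDiff Topology
open Set

noncomputable section
namespace FlowLog

section VF
variable {E : Type*} [NormedAddCommGroup E] [NormedSpace ℝ E]
  {M : Type*} [TopologicalSpace M] [ChartedSpace E M] [IsManifold 𝓘(ℝ, E) ∞ M]

variable (E M) in
/-- `Γ(TM)`: smooth vector fields on a manifold `M` without boundary, modelled on the vector
space `E`, as smooth sections of the tangent bundle. -/
abbrev SmoothVF : Type _ :=
  ContMDiffSection 𝓘(ℝ, E) E ∞ (TangentSpace 𝓘(ℝ, E) : M → Type _)

variable (E M) in
/-- `C^∞(M, ℝ)`. -/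
abbrev SmoothFun : Type _ := C^∞⟮𝓘(ℝ, E), M; 𝓘(ℝ, ℝ), ℝ⟯

theorem contMDiff_apply_vf (X : SmoothVF E M) (f : SmoothFun E M) :
    ContMDiff 𝓘(ℝ, E) 𝓘(ℝ, ℝ) ∞ (fun x : M => mvfderiv 𝓘(ℝ, E) f x (X x)) := by
  have h1 := f.contMDiff.contMDiff_tangentMap (m := ∞) (n := ∞) (by simp)
  have h2 := (contMDiff_snd_tangentBundle_modelSpace (n := ∞) ℝ 𝓘(ℝ, ℝ))
  exact h2.comp (h1.comp X.contMDiff)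

/-- A vector field `X` as a first order differential operator, `(X f)(x) = df_x (X x)`, on `C^∞(M, ℝ)`. -/
def vfOp (X : SmoothVF E M) : Module.End ℝ (SmoothFun E M) where
  toFun f := ⟨fun x => mvfderiv 𝓘(ℝ, E) f x (X x), contMDiff_apply_vf X f⟩
  map_add' f g := by
    ext x
    have hf := f.contMDiff.mdifferentiableAt (x := x) (by simp)
    have hg := g.contMDiff.mdifferentiableAt (x := x) (by simp)
    have := mvfderiv_add hf hg
    simp only [ContMDiffMap.coe_add, ContMDiffMap.coeFn_mk] at *
    rw [this]; rfl
  map_smul' c f := by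
    ext x
    have hf := f.contMDiff.mdifferentiableAt (x := x) (by simp)
    have := mvfderiv_smul (mdifferentiableAt_const (c := c) (x := x) (I := 𝓘(ℝ, E))) hf
    have h2 : ((fun _ : M => c) • (f : M → ℝ)) = ⇑(c • f) := rfl
    rw [h2] at this
    simp only [ContMDiffMap.coeFn_mk, this]
    rw [mvfderiv_const]
    simp
    rfl

theorem vfOp_apply (X : SmoothVF E M) (f : SmoothFun E M) (x : M) :
    vfOp X f x = mvfderiv 𝓘(ℝ, E) f x (X x) := rfl

/-- The linear inclusion of `Γ(TM)` into the algebra of linear operators on `C^∞(M, ℝ)`. -/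
def vfOpL : SmoothVF E M →ₗ[ℝ] Module.End ℝ (SmoothFun E M) where
  toFun := vfOp
  map_add' X Y := by
    ext f x
    rw [LinearMap.add_apply, ContMDiffMap.coe_add, Pi.add_apply]
    simp only [vfOp_apply]
    exact map_add _ _ _
  map_smul' c X := by
    ext f x
    rw [LinearMap.smul_apply, ContMDiffMap.coe_smul, Pi.smul_apply]
    simp only [vfOp_apply]
    exact map_smul _ _ _

/-- A vector field is determined by its action on smooth functions. -/
theorem vfOp_injective [FiniteDimensional ℝ E] [T2Space M] :
    Function.Injective (vfOp : SmoothVF E M → Module.End ℝ (SmoothFun E M)) := by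
  intro X Y h
  ext x
  obtain ⟨b⟩ : Nonempty (SmoothBumpFunction 𝓘(ℝ, E) x) := inferInstance
  have hℓ : ∀ l : E →L[ℝ] ℝ, l (X x) = l (Y x) := by
    intro l
    have hs : ContMDiffOn 𝓘(ℝ, E) 𝓘(ℝ, ℝ) ∞ (fun y : M => l (extChartAt 𝓘(ℝ, E) x y))
        (chartAt E x).source :=
      l.contDiff.contMDiff.comp_contMDiffOn (contMDiffOn_extChartAt (n := ∞))
    let f : SmoothFun E M := ⟨fun y => b y • l (extChartAt 𝓘(ℝ, E) x y), b.contMDiff_smul hs⟩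
    have hf : (f : M → ℝ) =ᶠ[𝓝 x] fun y => l (extChartAt 𝓘(ℝ, E) x y) := by
      filter_upwards [b.eventuallyEq_one] with y hy
      change b y • l (extChartAt 𝓘(ℝ, E) x y) = _
      rw [hy]; simp
    have hd : mvfderiv 𝓘(ℝ, E) f x = l := by
      have h1 : mfderiv 𝓘(ℝ, E) 𝓘(ℝ, ℝ) f x = mfderiv 𝓘(ℝ, E) 𝓘(ℝ, ℝ)
          (l ∘ extChartAt 𝓘(ℝ, E) x) x := hf.mfderiv_eq
      rw [mfderiv_comp x (I' := 𝓘(ℝ, E)) l.mdifferentiableAt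
        (mdifferentiableAt_extChartAt (mem_chart_source E x)), mfderiv_extChartAt_self,
        ContinuousLinearMap.mfderiv_eq] at h1
      exact h1
    have h2 := congrArg (fun D : Module.End ℝ (SmoothFun E M) => D f x) h
    simp only [vfOp_apply, hd] at h2
    exact h2
  by_contra hne
  obtain ⟨l, hl⟩ := SeparatingDual.exists_separating_of_ne (R := ℝ) (V := E) hne
  exact hl (hℓ l)

/-- The Lie bracket of smooth vector fields. -/
def vfBracket [CompleteSpace E] (X Y : SmoothVF E M) : SmoothVF E M :=
  ⟨VectorField.mlieBracket 𝓘(ℝ, E) X Y, fun x => by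
    have : IsManifold 𝓘(ℝ, E) (((⊤ : ℕ∞) : WithTop ℕ∞) + 1) M := by simpa
    have : IsManifold 𝓘(ℝ, E) (minSmoothness ℝ 2) M :=
      IsManifold.of_le (n := ∞) (by simp; exact WithTop.coe_le_coe.2 le_top)
    exact ContMDiffAt.mlieBracket_vectorField (m := ⊤) (n := ⊤) X.contMDiff.contMDiffAt
      Y.contMDiff.contMDiffAt (by simp)⟩

/-- As operators on functions, `[X, Y] = X Y - Y X`. -/
theorem vfOp_bracket [CompleteSpace E] (X Y : SmoothVF E M) : vfOp (vfBracket X Y) = ⁅vfOp X, vfOp Y⁆ := by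
  ext f x
  set φ := extChartAt 𝓘(ℝ, E) x with hφ
  have htgt : φ.target ∈ 𝓝 (φ x) := by
    exact extChartAt_target_mem_nhds x
  have hloc : ∀ (Z : SmoothVF E M) (g : SmoothFun E M), ∀ y ∈ φ.target,
      fderiv ℝ (g ∘ φ.symm) y
        (VectorField.mpullbackWithin 𝓘(ℝ, E) 𝓘(ℝ, E) φ.symm Z (range 𝓘(ℝ, E)) y)
        = vfOp Z g (φ.symm y) := by
    intro Z g y hy
    have hg := g.contMDiff.mdifferentiableAt (x := φ.symm y) (by simp)
    have hs := mdifferentiableWithinAt_extChartAt_symm (I := 𝓘(ℝ, E)) (x := x) hy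
    have hinv := isInvertible_mfderivWithin_extChartAt_symm (I := 𝓘(ℝ, E)) (x := x) hy
    simp only [VectorField.mpullbackWithin_apply]
    rw [← mfderiv_eq_fderiv]
    rw [modelWithCornersSelf_coe, range_id, mdifferentiableWithinAt_univ] at hs
    rw [mfderiv_comp y hg hs]
    rw [modelWithCornersSelf_coe, range_id, mfderivWithin_univ] at hinv ⊢
    obtain ⟨e, he⟩ := hinv
    rw [vfOp_apply]
    change (mfderiv 𝓘(ℝ, E) 𝓘(ℝ, ℝ) g (φ.symm y)) (mfderiv 𝓘(ℝ, E) 𝓘(ℝ, E) φ.symm y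
      ((mfderiv 𝓘(ℝ, E) 𝓘(ℝ, E) φ.symm y).inverse (Z (φ.symm y)))) = _
    rw [← he, ContinuousLinearMap.inverse_equiv]
    erw [ContinuousLinearEquiv.apply_symm_apply]
    rfl
  have hsm : ∀ (g : SmoothFun E M), ContDiffAt ℝ ∞ (g ∘ φ.symm) (φ x) := by
    intro g
    have h1 := contMDiffOn_extChartAt_symm (I := 𝓘(ℝ, E)) (n := ∞) x
    have h2 := (g.contMDiff.comp_contMDiffOn h1).contMDiffAt htgt
    exact h2.contDiffAt
  have hvf : ∀ (Z : SmoothVF E M), DifferentiableAt ℝ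
      (VectorField.mpullbackWithin 𝓘(ℝ, E) 𝓘(ℝ, E) φ.symm Z (range 𝓘(ℝ, E)) : E → E) (φ x) := by
    intro Z
    have h1 := VectorField.contMDiffWithinAt_mpullbackWithin_extChartAt_symm (I := 𝓘(ℝ, E))
      (n := ∞) (m := ∞) (s := univ) (x := x) Z.contMDiff.contMDiffAt.contMDiffWithinAt
      uniqueMDiffOn_univ (mem_univ _) (by simp)
    have h2 := contMDiffWithinAt_vectorSpace_iff_contDiffWithinAt.1 h1
    rw [preimage_univ, inter_univ] at h2
    exact (h2.contDiffAt htgt).differentiableAt (by simp)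
  have key := VectorField.fderiv_apply_lieBracket (hsm f)
    (by simp; exact WithTop.coe_le_coe.2 le_top) (hvf Y) (hvf X)
  have hev : ∀ (Z : SmoothVF E M) (g : SmoothFun E M), (fun y => fderiv ℝ (g ∘ φ.symm) y
        (VectorField.mpullbackWithin 𝓘(ℝ, E) 𝓘(ℝ, E) φ.symm Z (range 𝓘(ℝ, E)) y))
        =ᶠ[𝓝 (φ x)] (vfOp Z g) ∘ φ.symm := fun Z g =>
    Filter.eventually_of_mem htgt fun y hy => hloc Z g y hy
  have hxt : φ x ∈ φ.target := mem_extChartAt_target x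
  have hxx : φ.symm (φ x) = x := extChartAt_to_inv x
  rw [(hev Y f).fderiv_eq, (hev X f).fderiv_eq, hloc X _ _ hxt, hloc Y _ _ hxt, hxx] at key
  rw [Ring.lie_def, LinearMap.sub_apply, ContMDiffMap.coe_sub, Pi.sub_apply]
  refine Eq.trans ?_ key
  have hb : VectorField.mlieBracket 𝓘(ℝ, E) X Y x = VectorField.lieBracket ℝ
      (VectorField.mpullbackWithin 𝓘(ℝ, E) 𝓘(ℝ, E) φ.symm X (range 𝓘(ℝ, E)))
      (VectorField.mpullbackWithin 𝓘(ℝ, E) 𝓘(ℝ, E) φ.symm Y (range 𝓘(ℝ, E))) (φ x) := by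
    rw [VectorField.mlieBracket, VectorField.mlieBracketWithin_apply, mfderiv_extChartAt_self]
    refine (congrArg (fun L : E →L[ℝ] E => L _) ContinuousLinearMap.inverse_id).trans ?_
    simp only [preimage_univ, modelWithCornersSelf_coe, range_id, inter_univ]
    exact congrFun VectorField.lieBracketWithin_univ _
  rw [vfOp_apply]
  change mvfderiv 𝓘(ℝ, E) f x (VectorField.mlieBracket 𝓘(ℝ, E) X Y x) = _
  rw [hb]
  have hf := f.contMDiff.mdifferentiableAt (x := φ.symm (φ x)) (by simp)
  have hs := mdifferentiableWithinAt_extChartAt_symm (I := 𝓘(ℝ, E)) (x := x) hxt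
  rw [modelWithCornersSelf_coe, range_id, mdifferentiableWithinAt_univ] at hs
  have hid := mfderivWithin_range_extChartAt_symm (I := 𝓘(ℝ, E)) (x := x)
  simp only [modelWithCornersSelf_coe, range_id, mfderivWithin_univ] at hid
  have e1 : fderiv ℝ (f ∘ φ.symm) (φ x) = mvfderiv 𝓘(ℝ, E) f (φ.symm (φ x)) := by
    rw [← mfderiv_eq_fderiv, mfderiv_comp _ hf hs, hid]
    rfl
  rw [e1, hxx]
  rfl

end VF

section Tensor

/-- The tensor algebra `T(ℝ^d)`. -/
abbrev Tens (d : ℕ) : Type := TensorAlgebra ℝ (EuclideanSpace ℝ (Fin d))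

variable {d : ℕ}

/-- The copy of `ℝ^d` inside `T(ℝ^d)`. -/
def letters (d : ℕ) : Submodule ℝ (Tens d) :=
  LinearMap.range (TensorAlgebra.ι ℝ : EuclideanSpace ℝ (Fin d) →ₗ[ℝ] Tens d)

/-- `A ↦ A_k`, the component in `(ℝ^d)^{⊗ k}`. -/
def homPart (k : ℕ) : Tens d →ₗ[ℝ] Tens d :=
  GradedAlgebra.proj
    (fun i : ℕ => LinearMap.range (TensorAlgebra.ι ℝ : EuclideanSpace ℝ (Fin d) →ₗ[ℝ] Tens d) ^ i) k

/-- The projection `π_{≤ κ}` onto `T^{(κ)}(ℝ^d) = ⨁_{k ≤ κ} (ℝ^d)^{⊗ k}`, viewed as a subspace of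
`T(ℝ^d)`. -/
def trunc (κ : ℕ) : Tens d →ₗ[ℝ] Tens d := ∑ k ∈ Finset.range (κ + 1), homPart k

/-- The complementary projection `π_{> κ}`. -/
def truncAbove (κ : ℕ) : Tens d →ₗ[ℝ] Tens d := LinearMap.id - trunc κ

/-- The commutator `[A, B]_⊗` in `T(ℝ^d)`. -/
def brTensor (A B : Tens d) : Tens d := A * B - B * A

/-- The bracket of `T^{(κ)}(ℝ^d)`: `[A, B] = π_{≤ κ} [A, B]_⊗`. -/
def brTrunc (κ : ℕ) (A B : Tens d) : Tens d := trunc κ (brTensor A B)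

/-- The smallest linear subspace containing `ℝ^d` and closed under the bracket `br`, that is the
Lie subalgebra generated by `ℝ^d`. -/
def lieGen (br : Tens d → Tens d → Tens d) : Submodule ℝ (Tens d) :=
  sInf {S : Submodule ℝ (Tens d) | letters d ≤ S ∧ ∀ A ∈ S, ∀ B ∈ S, br A B ∈ S}

/-- The free Lie algebra `F(ℝ^d)`, the Lie subalgebra of `(T(ℝ^d), [·,·]_⊗)` generated by `ℝ^d`. -/
def freeLie (d : ℕ) : Submodule ℝ (Tens d) := lieGen brTensor

/-- The step `κ` free nilpotent Lie algebra `F^{(κ)}(ℝ^d)`, the Lie subalgebra of `T^{(κ)}(ℝ^d)`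
(with the truncated bracket) generated by `ℝ^d`. It is used for `κ ≥ 1`. -/
def freeNil (d κ : ℕ) : Submodule ℝ (Tens d) := lieGen (brTrunc κ)

/-- `ad_A B = [A, B] = π_{≤ κ} [A, B]_⊗`. -/
def truncAd (κ : ℕ) (A : Tens d) : Module.End ℝ (Tens d) :=
  trunc κ ∘ₗ (LinearMap.mulLeft ℝ A - LinearMap.mulRight ℝ A)

/-- `e^A = ∑_{k ≤ κ} A^k / k!` in the truncated algebra `T^{(κ)}(ℝ^d)`, for `A` without constant
term. -/
def truncExp (κ : ℕ) (A : Tens d) : Tens d :=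
  trunc κ (∑ k ∈ Finset.range (κ + 1), ((k.factorial : ℝ)⁻¹) • A ^ k)

/-- `Ad_{e^A} B = e^A B (e^A)⁻¹ = e^A B e^{-A}`, products being those of `T^{(κ)}(ℝ^d)`. -/
def truncAdExp (κ : ℕ) (A B : Tens d) : Tens d :=
  trunc κ (truncExp κ A * B * truncExp κ (-A))

/-- The Taylor series at `0` of `ψ(z) = (e^z - 1) / z`. -/
def psi : PowerSeries ℝ := PowerSeries.mk fun k => (((k + 1).factorial : ℝ))⁻¹

theorem X_mul_psi : PowerSeries.X * psi = PowerSeries.exp ℝ - 1 := by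
  ext n
  cases n with
  | zero => simp
  | succ n => simp [psi, PowerSeries.coeff_succ_X_mul, PowerSeries.coeff_exp, PowerSeries.coeff_one]

/-- `f(L) = ∑_k a_k L^k` for `f = ∑_k a_k z^k` and `L` a scalar multiple of `ad_A`,
`A ∈ F^{(κ)}(ℝ^d)`; the sum stops at `k = κ - 1` because `ad_A^κ = 0` on `T^{(κ)}(ℝ^d)`. -/
def nilpEval (κ : ℕ) (f : PowerSeries ℝ) (L : Module.End ℝ (Tens d)) : Module.End ℝ (Tens d) :=
  ∑ k ∈ Finset.range κ, PowerSeries.coeff k f • L ^ k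

theorem letters_le_lieGen (br : Tens d → Tens d → Tens d) : letters d ≤ lieGen br :=
  le_sInf fun _ hS => hS.1

theorem br_mem_lieGen {br : Tens d → Tens d → Tens d} {A B : Tens d} (hA : A ∈ lieGen br)
    (hB : B ∈ lieGen br) : br A B ∈ lieGen br := by
  rw [lieGen, Submodule.mem_sInf] at *
  exact fun S hS => hS.2 A (hA S hS) B (hB S hS)

theorem homPart_mem_freeLie {A : Tens d} (hA : A ∈ freeLie d) (k : ℕ) :
    homPart k A ∈ freeLie d := by
  classical
  let 𝒜 : ℕ → Submodule ℝ (Tens d) := fun i : ℕ => LinearMap.range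
      (TensorAlgebra.ι ℝ : EuclideanSpace ℝ (Fin d) →ₗ[ℝ] Tens d) ^ i
  have hsum : ∀ C : Tens d, ∃ s : Finset ℕ, C = ∑ i ∈ s, homPart i C := fun C =>
    ⟨_, (DirectSum.sum_support_decompose 𝒜 C).symm⟩
  have hhom : ∀ (i : ℕ) (C : Tens d), C ∈ 𝒜 i → C ∈ freeLie d →
      ∀ k, homPart k C ∈ freeLie d := by
    intro i C hC hF k
    by_cases hik : i = k
    · subst hik
      have : homPart i C = C := DirectSum.decompose_of_mem_same 𝒜 hC
      rw [this]; exact hF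
    · have : homPart k C = 0 := DirectSum.decompose_of_mem_ne 𝒜 hC hik
      rw [this]; exact zero_mem _
  have hmem : ∀ (i : ℕ) (C : Tens d), homPart i C ∈ 𝒜 i := fun i C => SetLike.coe_mem _
  have hle : freeLie d ≤ ⨅ k, (freeLie d).comap (homPart k) := by
    refine sInf_le ⟨fun x hx => ?_, fun x hx y hy => ?_⟩
    · rw [Submodule.mem_iInf]
      exact hhom 1 x (by simpa [𝒜, letters] using hx) (letters_le_lieGen _ hx)
    · rw [Submodule.mem_iInf] at *
      intro k
      obtain ⟨s, hs⟩ := hsum x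
      obtain ⟨t, ht⟩ := hsum y
      have hb : brTensor x y = ∑ i ∈ s, ∑ j ∈ t, brTensor (homPart i x) (homPart j y) := by
        conv_lhs => rw [hs, ht]
        simp only [brTensor, Finset.sum_mul_sum, Finset.sum_sub_distrib]
        congr 1
        exact Finset.sum_comm
      rw [Submodule.mem_comap, hb, map_sum]
      refine sum_mem fun i _ => ?_
      rw [map_sum]
      refine sum_mem fun j _ => ?_
      refine hhom (i + j) _ (sub_mem ?_ ?_) (br_mem_lieGen (hx i) (hy j)) k
      · exact SetLike.GradedMul.mul_mem (A := 𝒜) (hmem i x) (hmem j y)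
      · rw [add_comm]
        exact SetLike.GradedMul.mul_mem (A := 𝒜) (hmem j y) (hmem i x)
  exact (Submodule.mem_iInf _).1 (hle hA) k

theorem trunc_mem_freeLie {A : Tens d} (hA : A ∈ freeLie d) (κ : ℕ) : trunc κ A ∈ freeLie d := by
  simp only [trunc, LinearMap.sum_apply]
  exact sum_mem fun k _ => homPart_mem_freeLie hA k

theorem truncAbove_mem_freeLie {A : Tens d} (hA : A ∈ freeLie d) (κ : ℕ) :
    truncAbove κ A ∈ freeLie d :=
  sub_mem hA (trunc_mem_freeLie hA κ)

/-- `F^{(κ)}(ℝ^d) ⊆ F(ℝ^d)` as subspaces of `T(ℝ^d)`. -/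
theorem freeNil_le_freeLie (κ : ℕ) : freeNil d κ ≤ freeLie d :=
  sInf_le ⟨letters_le_lieGen _, fun _ hA _ hB => trunc_mem_freeLie (br_mem_lieGen hA hB) κ⟩

theorem nilpEval_mem_freeNil (κ : ℕ) (f : PowerSeries ℝ) (c : ℝ) {A B : Tens d}
    (hA : A ∈ freeNil d κ) (hB : B ∈ freeNil d κ) :
    nilpEval κ f (c • truncAd κ A) B ∈ freeNil d κ := by
  have h1 : ∀ k : ℕ, ((c • truncAd κ A) ^ k) B ∈ freeNil d κ := by
    intro k
    induction k with
    | zero => simpa using hB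
    | succ k ih =>
      rw [pow_succ', Module.End.mul_apply]
      exact Submodule.smul_mem _ c (br_mem_lieGen hA ih)
  simp only [nilpEval, LinearMap.sum_apply, LinearMap.smul_apply]
  exact sum_mem fun k _ => Submodule.smul_mem _ _ (h1 k)

/-- `ξ` is `C¹` on `[0, T]` with derivative `ξ'` (one-sided at the endpoints). For curves in a
finite-dimensional subspace of `W`, as used here, testing against all linear functionals is the
same as working in any norm or in any coordinates. -/
def IsC1On {W : Type*} [AddCommGroup W] [Module ℝ W] (T : ℝ) (ξ ξ' : ℝ → W) : Prop :=
  ∀ l : W →ₗ[ℝ] ℝ,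
    (∀ t ∈ Icc 0 T, HasDerivWithinAt (fun r => l (ξ r)) (l (ξ' t)) (Icc 0 T) t) ∧
    ContinuousOn (fun r => l (ξ' r)) (Icc 0 T)

/-- `J = ∫₀¹ u(s) ds`, tested against all linear functionals. For `u` with values in a
finite-dimensional subspace of `W`, as used here, this is the usual integral, and `J` is unique. -/
def HasIntegral01 {W : Type*} [AddCommGroup W] [Module ℝ W] (u : ℝ → W) (J : W) : Prop :=
  ∀ l : W →ₗ[ℝ] ℝ, IntervalIntegrable (fun s => l (u s)) MeasureTheory.volume 0 1 ∧
    ∫ s in (0 : ℝ)..1, l (u s) = l J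

end Tensor

section Dyn
variable {E : Type*} [NormedAddCommGroup E] [NormedSpace ℝ E]
  {M : Type*} [TopologicalSpace M] [ChartedSpace E M] [IsManifold 𝓘(ℝ, E) ∞ M] {d : ℕ}

variable (E M) in
/-- A `d`-dimensional dynamical system on `M`: a linear map `ℝ^d → Γ(TM)`. -/
abbrev DynSys (d : ℕ) : Type _ := EuclideanSpace ℝ (Fin d) →ₗ[ℝ] SmoothVF E M

/-- The extension of `V` to an algebra homomorphism from `T(ℝ^d)` to the linear (differential)
operators on `C^∞(M, ℝ)`. -/
def extOp (V : DynSys E M d) : Tens d →ₐ[ℝ] Module.End ℝ (SmoothFun E M) :=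
  TensorAlgebra.lift ℝ (vfOpL ∘ₗ V)

open Classical in
/-- `V_A` as a vector field: the (unique) vector field whose operator is `V_A`. It exists for every
`A ∈ F(ℝ^d)`, see `vfOp_extVF`; for other `A` the value is irrelevant. -/
def extVF (V : DynSys E M d) (A : Tens d) : SmoothVF E M :=
  if h : ∃ X : SmoothVF E M, vfOp X = extOp V A then h.choose else 0

theorem vfOp_extVF [CompleteSpace E] (V : DynSys E M d) {A : Tens d} (hA : A ∈ freeLie d) :
    vfOp (extVF V A) = extOp V A := by
  have h : ∃ X : SmoothVF E M, vfOp X = extOp V A := by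
    have hle : freeLie d ≤ ((vfOpL : SmoothVF E M →ₗ[ℝ] _).range).comap
        (extOp V).toLinearMap := by
      refine sInf_le ⟨?_, ?_⟩
      · rintro _ ⟨w, rfl⟩
        exact ⟨V w, by simp [extOp]⟩
      · rintro x ⟨X, hX⟩ y ⟨Y, hY⟩
        refine ⟨vfBracket X Y, ?_⟩
        have hX' : vfOp X = extOp V x := hX
        have hY' : vfOp Y = extOp V y := hY
        change vfOp (vfBracket X Y) = extOp V (x * y - y * x)
        rw [vfOp_bracket, hX', hY', Ring.lie_def, map_sub, map_mul, map_mul]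
    exact hle hA
  rw [extVF, dif_pos h]
  exact h.choose_spec

/-- A time independent vector field is complete: every point lies on an integral curve defined for
all times. -/
def IsCompleteVF (X : SmoothVF E M) : Prop :=
  ∀ m : M, ∃ γ : ℝ → M, γ 0 = m ∧ IsMIntegralCurve γ (fun x => X x)

open Classical in
/-- The flow `e^{tX}` of a complete vector field `X`. -/
def flow (X : SmoothVF E M) (t : ℝ) (m : M) : M :=
  if h : ∃ γ : ℝ → M, γ 0 = m ∧ IsMIntegralCurve γ (fun x => X x) then h.choose t else m

/-- For complete `X`, the maps `e^{tX}` and `e^{-tX}` are inverse to each other. -/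
theorem flow_flow_neg [CompleteSpace E] [T2Space M] {X : SmoothVF E M} (hX : IsCompleteVF X)
    (t : ℝ) (m : M) : flow X t (flow X (-t) m) = m := by
  have hspec : ∀ m, flow X 0 m = m ∧ IsMIntegralCurve (fun t => flow X t m) (fun x => X x) := by
    intro m
    have h := (hX m).choose_spec
    simp only [flow, dif_pos (hX m)]
    exact h
  have hc := (hspec m).2.comp_add (-t)
  have heq := isMIntegralCurve_Ioo_eq_of_contMDiff_boundaryless (t₀ := 0)
    (X.contMDiff.of_le (by simp)) hc (hspec (flow X (-t) m)).2 (by simp [(hspec _).1])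
  have := congrFun heq t
  simp only [Function.comp, add_neg_cancel] at this
  rw [← this]; exact (hspec m).1

/-- `Ad_{e^{sX}} Y = (e^{sX})_* Y ∘ e^{-sX}`. -/
def adFlow (X : SmoothVF E M) (s : ℝ) (Y : SmoothVF E M) (m : M) : TangentSpace 𝓘(ℝ, E) m :=
  mfderiv 𝓘(ℝ, E) 𝓘(ℝ, E) (flow X s) (flow X (-s) m) (Y (flow X (-s) m))

/-- A time dependent vector field `Y_t`, `t ∈ [0, T]`, is complete: for every initial time
`s ∈ [0, T]` and point `m` there is a solution on all of `[0, T]` (one-sided derivatives at the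
endpoints) of `σ'(t) = Y_t(σ(t))`, `σ(s) = m`. -/
def IsCompleteOn (T : ℝ) (Y : ℝ → SmoothVF E M) : Prop :=
  ∀ s ∈ Icc 0 T, ∀ m : M, ∃ σ : ℝ → M, σ s = m ∧ ∀ t ∈ Icc 0 T,
    HasMFDerivWithinAt 𝓘(ℝ, ℝ) 𝓘(ℝ, E) σ (Icc 0 T) t
      ((1 : ℝ →L[ℝ] ℝ).smulRight (Y t (σ t)))

/-- `V` is `κ`-complete on `[0, T]`: for every `C¹` curve `ξ` in `F^{(κ)}(ℝ^d)` the time dependent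
vector field `V_{ξ'(t)}` is complete. -/
def IsKappaComplete (κ : ℕ) (T : ℝ) (V : DynSys E M d) : Prop :=
  ∀ ξ ξ' : ℝ → Tens d, (∀ t ∈ Icc 0 T, ξ t ∈ freeNil d κ) → IsC1On T ξ ξ' →
    IsCompleteOn T (fun t => extVF V (ξ' t))

/-- At each point `m`, the curve `s ↦ Z_s(m)` in the fixed finite-dimensional space `T_m M` is
integrable over `[0, 1]`. -/
def VFIntegrable (Z : ℝ → ∀ m : M, TangentSpace 𝓘(ℝ, E) m) : Prop :=
  ∀ m : M, IntervalIntegrable (ε := E) (fun s => Z s m) MeasureTheory.volume 0 1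

/-- The vector field `∫₀¹ Z_s ds`, computed in `T_m M` at each point `m`. -/
def vfIntegral (Z : ℝ → ∀ m : M, TangentSpace 𝓘(ℝ, E) m) (m : M) : TangentSpace 𝓘(ℝ, E) m :=
  intervalIntegral (E := E) (fun s => Z s m) 0 1 MeasureTheory.volume

end Dyn
end FlowLog

end

open FlowLog

/-!
The identity is the fundamental theorem of calculus for the curve `s ↦ Ad_{e^{sX}} V_{C(s)}`, where
`X = V_A` and `C(s) = (s - 1) ψ((s - 1) ad_A) B`. This curve vanishes at `s = 1` and equals
`-V_{ψ(-ad_A) B}` at `s = 0`. Since `d/ds Ad_{e^{sX}} Y = -Ad_{e^{sX}} [X, Y]`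
(`hasDerivAt_adFlow`) and `V` maps brackets of the free Lie algebra to brackets of vector fields
(`vfBracket_extVF`), the derivative of the curve is `Ad_{e^{sX}} V_{C'(s) - [A, C(s)]_⊗}`. Splitting
`[A, C]_⊗ = ad_A C + π_{>κ} [A, C]_⊗` and using `C'(s) - ad_A C(s) = B`, which holds because
`ad_A^κ B = 0` (`truncAd_pow_eq_zero`), gives the integrand of the theorem; see
`vfIntegral_adFlow_eq`. The other form of the first term on the right is
`∫₀¹ Ad_{e^{-sA}} B ds = ψ(-ad_A) B` (`hasIntegral01_truncAdExp`), obtained from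
`Ad_{e^A} = e^{ad_A}` by integrating a polynomial in `s`.

The formula for the derivative needs the flow to be differentiable in the initial point and its
space derivative to be differentiable in time at `0`. In a chart this is
`exists_localFlow_hasFDerivAt`: the equation and its linearization are solved together by the
Picard–Lindelöf theorem, and Grönwall's inequality shows that the solution of the linearized
equation is the space derivative of the flow. Differentiability for all times follows from that for
small times (`mdifferentiableAt_flow`), and the general derivative from the one at `s = 0` by the
group property of the flow (`adFlow_add`).
-/

noncomputable section
namespace FlowLog

/-! ### Differentiability of local flows in the initial point -/

section ODE
variable {F : Type*} [NormedAddCommGroup F] [NormedSpace ℝ F]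

theorem gronwallBound_zero_eq_mul (K δ x : ℝ) :
    gronwallBound 0 K δ x = δ * gronwallBound 0 K 1 x := by
  by_cases hK : K = 0
  · subst hK
    simp only [gronwallBound_K0]
    ring
  · simp only [gronwallBound_of_K_ne_0 hK]
    ring

/-- Two-sided form of Grönwall's inequality, centred at time `0`. -/
theorem norm_le_gronwallBound_abs {f f' : ℝ → F} {K δ ε : ℝ}
    (hf : ∀ t ∈ Ioo (-ε) ε, HasDerivAt f (f' t) t)
    (hb : ∀ t ∈ Ioo (-ε) ε, ‖f' t‖ ≤ K * ‖f t‖ + δ) {t : ℝ} (ht : t ∈ Ioo (-ε) ε) :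
    ‖f t‖ ≤ gronwallBound ‖f 0‖ K δ |t| := by
  have key : ∀ {g g' : ℝ → F}, (∀ t ∈ Ioo (-ε) ε, HasDerivAt g (g' t) t) →
      (∀ t ∈ Ioo (-ε) ε, ‖g' t‖ ≤ K * ‖g t‖ + δ) → ∀ {t : ℝ}, 0 ≤ t → t < ε →
      ‖g t‖ ≤ gronwallBound ‖g 0‖ K δ t := by
    intro g g' hg hgb t h0 h1
    have hsub : Icc 0 t ⊆ Ioo (-ε) ε := fun u hu =>
      ⟨by linarith [hu.1], by linarith [hu.2]⟩
    have := norm_le_gronwallBound_of_norm_deriv_right_le (f := g) (f' := g') (a := 0) (b := t)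
      (δ := ‖g 0‖) (K := K) (ε := δ)
      (fun u hu => (hg u (hsub hu)).continuousAt.continuousWithinAt)
      (fun u hu => (hg u (hsub (Ico_subset_Icc_self hu))).hasDerivWithinAt) le_rfl
      (fun u hu => hgb u (hsub (Ico_subset_Icc_self hu))) t ⟨h0, le_rfl⟩
    simpa using this
  rcases le_total 0 t with h | h
  · rw [abs_of_nonneg h]
    exact key hf hb h ht.2
  · rw [abs_of_nonpos h]
    have h2 := key (g := fun u => f (-u)) (g' := fun u => -f' (-u))
      (fun u hu => by
        have := (hf (-u) ⟨by linarith [hu.2], by linarith [hu.1]⟩).scomp u (hasDerivAt_neg u)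
        rw [neg_one_smul] at this
        exact this)
      (fun u hu => by
        have := hb (-u) ⟨by linarith [hu.2], by linarith [hu.1]⟩
        simpa using this) (t := -t) (by linarith) (by linarith [ht.1])
    simpa using h2

/-- Local solutions of an autonomous `C¹` equation exist for a uniform time and remain in a
prescribed neighbourhood of the base point. -/
theorem exists_localFlow [CompleteSpace F] {W : F → F} {z₀ : F} (hW : ContDiffAt ℝ 1 W z₀)
    {N : Set F} (hN : N ∈ 𝓝 z₀) :
    ∃ (α : F → ℝ → F) (r ε : ℝ), 0 < r ∧ 0 < ε ∧ ∀ z ∈ Metric.ball z₀ r, α z 0 = z ∧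
      ∀ t ∈ Ioo (-ε) ε, HasDerivAt (α z) (W (α z t)) t ∧ α z t ∈ N := by
  obtain ⟨ε, hε, a, r, L, K, hr, hpl⟩ := IsPicardLindelof.of_contDiffAt_one hW
  obtain ⟨α, hα, hc⟩ :=
    (hpl 0).exists_forall_mem_closedBall_eq_hasDerivWithinAt_continuousOn
  have hr' : (0 : ℝ) < r := hr
  simp only [zero_sub, zero_add] at hα hc
  have hz : α (z₀, 0) = z₀ := (hα z₀ (Metric.mem_closedBall_self hr'.le)).1
  have hat : ContinuousAt α (z₀, 0) := hc.continuousAt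
    (prod_mem_nhds (Metric.closedBall_mem_nhds _ hr') (Icc_mem_nhds (by linarith) hε))
  have hpre : α ⁻¹' N ∈ 𝓝 (z₀, (0 : ℝ)) := hat.preimage_mem_nhds (by rwa [hz])
  rw [Metric.mem_nhds_iff] at hpre
  obtain ⟨ρ, hρ, hball⟩ := hpre
  refine ⟨fun z t => α (z, t), min r ρ, min ε ρ, lt_min hr' hρ, lt_min hε hρ, fun z hz => ?_⟩
  have hzr := hα z (Metric.closedBall_subset_closedBall (min_le_left _ _)
    (Metric.ball_subset_closedBall hz))
  refine ⟨hzr.1, fun t ht => ⟨?_, ?_⟩⟩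
  · have h1 : -ε < t := by linarith [ht.1, min_le_left ε ρ]
    have h2 : t < ε := by linarith [ht.2, min_le_left ε ρ]
    exact (hzr.2 t ⟨h1.le, h2.le⟩).hasDerivAt (Icc_mem_nhds h1 h2)
  · refine hball ?_
    rw [← ball_prod_same]
    refine ⟨Metric.ball_subset_ball (min_le_right _ _) hz, ?_⟩
    rw [Metric.mem_ball, Real.dist_eq, sub_zero, abs_lt]
    exact ⟨by linarith [ht.1, min_le_right ε ρ], by linarith [ht.2, min_le_right ε ρ]⟩

/-- Quadratic estimate of the first order Taylor remainder, for a field with Lipschitz derivative. -/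
theorem norm_sub_sub_fderiv_le {v : F → F} {s : Set F} (hs : Convex ℝ s)
    (hv : ∀ x ∈ s, DifferentiableAt ℝ v x) {C : NNReal} (hC : LipschitzOnWith C (fderiv ℝ v) s)
    {a b : F} (ha : a ∈ s) (hb : b ∈ s) :
    ‖v b - v a - fderiv ℝ v a (b - a)‖ ≤ C * ‖b - a‖ * ‖b - a‖ := by
  have hsub := hs.segment_subset ha hb
  refine (convex_segment a b).norm_image_sub_le_of_norm_hasFDerivWithin_le'
    (f' := fderiv ℝ v) (fun x hx => (hv x (hsub hx)).hasFDerivAt.hasFDerivWithinAt)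
    (fun x hx => ?_) (left_mem_segment ℝ a b) (right_mem_segment ℝ a b)
  refine (hC.norm_sub_le (hsub hx) ha).trans ?_
  gcongr
  exact norm_sub_le_of_mem_segment hx

/-- Differentiability of the flow of a `C²` vector field in the initial point. Here `D x t` is the
space derivative at `x` of the flow at time `t`; the last clause is the variational equation at
time `0`. -/
theorem exists_localFlow_hasFDerivAt [CompleteSpace F] {v : F → F} {x₀ : F}
    (hv : ContDiffAt ℝ 2 v x₀) {U : Set F} (hU : U ∈ 𝓝 x₀) :
    ∃ (α : F → ℝ → F) (D : F → ℝ → F →L[ℝ] F) (r ε : ℝ), 0 < r ∧ 0 < ε ∧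
      ∀ x ∈ Metric.ball x₀ r, α x 0 = x ∧ D x 0 = 1 ∧ HasDerivAt (D x) (fderiv ℝ v x) 0 ∧
        ∀ t ∈ Ioo (-ε) ε, HasDerivAt (α x) (v (α x t)) t ∧ α x t ∈ U ∧
          HasFDerivAt (fun y => α y t) (D x t) x := by
  have hv' : ContDiffAt ℝ 1 (fderiv ℝ v) x₀ := hv.fderiv_right (by norm_num)
  obtain ⟨C, sC, hsC, hC⟩ := hv'.exists_lipschitzOnWith
  obtain ⟨K, sK, hsK, hK⟩ := (hv.of_le (by norm_num) : ContDiffAt ℝ 1 v x₀).exists_lipschitzOnWith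
  have hdiff : ∀ᶠ x in 𝓝 x₀, DifferentiableAt ℝ v x :=
    (hv.eventually (by simp)).mono fun x hx => hx.differentiableAt (by norm_num)
  obtain ⟨ρ, hρ, hball⟩ := Metric.mem_nhds_iff.1
    (Filter.inter_mem (Filter.inter_mem hsC hsK) (Filter.inter_mem hdiff hU))
  set s := Metric.ball x₀ ρ with hs
  have hconv : Convex ℝ s := convex_ball x₀ ρ
  have hsopen : IsOpen s := Metric.isOpen_ball
  replace hC : LipschitzOnWith C (fderiv ℝ v) s := hC.mono fun x hx => (hball hx).1.1
  replace hK : LipschitzOnWith K v s := hK.mono fun x hx => (hball hx).1.2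
  have hd : ∀ x ∈ s, DifferentiableAt ℝ v x := fun x hx => (hball hx).2.1
  have hKn : ∀ x ∈ s, ‖fderiv ℝ v x‖ ≤ K := fun x hx =>
    norm_fderiv_le_of_lipschitzOn ℝ (hsopen.mem_nhds hx) hK
  -- the equation for the flow together with its linearization
  let W : F × (F →L[ℝ] F) → F × (F →L[ℝ] F) := fun z => (v z.1, (fderiv ℝ v z.1).comp z.2)
  have hW : ContDiffAt ℝ 1 W (x₀, 1) := by
    have h1 : ContDiffAt ℝ 1 (fun z : F × (F →L[ℝ] F) => v z.1) (x₀, 1) :=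
      ContDiffAt.comp (x₀, (1 : F →L[ℝ] F)) (hv.of_le (by norm_num)) contDiffAt_fst
    have h2 : ContDiffAt ℝ 1 (fun z : F × (F →L[ℝ] F) => fderiv ℝ v z.1) (x₀, 1) :=
      ContDiffAt.comp (x₀, (1 : F →L[ℝ] F)) hv' contDiffAt_fst
    exact h1.prodMk (h2.clm_comp contDiffAt_snd)
  obtain ⟨β, r, ε, hr, hε, hβ⟩ := exists_localFlow hW (N := s ×ˢ univ)
    (prod_mem_nhds (Metric.ball_mem_nhds _ hρ) Filter.univ_mem)
  have hmem : ∀ x ∈ Metric.ball x₀ r, (x, (1 : F →L[ℝ] F)) ∈ Metric.ball (x₀, 1) r := by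
    intro x hx
    rw [← ball_prod_same]
    exact ⟨hx, Metric.mem_ball_self hr⟩
  have hα : ∀ x ∈ Metric.ball x₀ r, ∀ t ∈ Ioo (-ε) ε,
      HasDerivAt (fun t => (β (x, 1) t).1) (v (β (x, 1) t).1) t := fun x hx t ht =>
    ((hβ _ (hmem x hx)).2 t ht).1.fst
  have hD : ∀ x ∈ Metric.ball x₀ r, ∀ t ∈ Ioo (-ε) ε, HasDerivAt (fun t => (β (x, 1) t).2)
      ((fderiv ℝ v (β (x, 1) t).1).comp (β (x, 1) t).2) t := fun x hx t ht =>
    ((hβ _ (hmem x hx)).2 t ht).1.snd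
  have hαs : ∀ x ∈ Metric.ball x₀ r, ∀ t ∈ Ioo (-ε) ε, (β (x, 1) t).1 ∈ s :=
    fun x hx t ht => ((hβ _ (hmem x hx)).2 t ht).2.1
  have h0 : ∀ x ∈ Metric.ball x₀ r, β (x, 1) 0 = (x, 1) := fun x hx => (hβ _ (hmem x hx)).1
  have hzero : (0 : ℝ) ∈ Ioo (-ε) ε := ⟨by linarith, hε⟩
  -- Lipschitz dependence on the initial point
  have hlip : ∀ x ∈ Metric.ball x₀ r, ∀ y ∈ Metric.ball x₀ r, ∀ t ∈ Ioo (-ε) ε,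
      ‖(β (y, 1) t).1 - (β (x, 1) t).1‖ ≤ Real.exp (K * ε) * ‖y - x‖ := by
    intro x hx y hy t ht
    have := norm_le_gronwallBound_abs (f := fun t => (β (y, 1) t).1 - (β (x, 1) t).1)
      (K := K) (δ := 0) (fun t ht => (hα y hy t ht).sub (hα x hx t ht))
      (fun t ht => by
        simpa using hK.norm_sub_le (hαs y hy t ht) (hαs x hx t ht)) ht
    rw [gronwallBound_ε0, h0 x hx, h0 y hy, mul_comm] at this
    refine this.trans ?_
    gcongr
    exact (abs_lt.2 ⟨ht.1, ht.2⟩).le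
  refine ⟨fun x t => (β (x, 1) t).1, fun x t => (β (x, 1) t).2, r, ε, hr, hε, fun x hx =>
    ⟨by simp [h0 x hx], by simp [h0 x hx], ?_, fun t ht => ⟨hα x hx t ht,
      (hball (hαs x hx t ht)).2.2, ?_⟩⟩⟩
  · have := hD x hx 0 hzero
    rw [h0 x hx] at this
    exact this
  · set G := gronwallBound 0 K 1 ε with hG
    set Q := C * (Real.exp (K * ε)) ^ 2 * G with hQ
    -- `δ` bounds the inhomogeneity in the equation for the Taylor remainder of the flow
    have hest : ∀ y ∈ Metric.ball x₀ r,
        ‖(β (y, 1) t).1 - (β (x, 1) t).1 - (β (x, 1) t).2 (y - x)‖ ≤ Q * ‖y - x‖ ^ 2 := by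
      intro y hy
      set δ := C * (Real.exp (K * ε)) ^ 2 * ‖y - x‖ ^ 2 with hδ
      have hδ0 : 0 ≤ δ := by positivity
      have h1 := norm_le_gronwallBound_abs
        (f := fun t => (β (y, 1) t).1 - (β (x, 1) t).1 - (β (x, 1) t).2 (y - x))
        (K := K) (δ := δ) (fun t ht => ((hα y hy t ht).sub (hα x hx t ht)).sub
          ((hD x hx t ht).clm_apply (hasDerivAt_const t (y - x))))
        (fun t ht => by
          have e1 := norm_sub_sub_fderiv_le hconv hd hC (hαs x hx t ht) (hαs y hy t ht)
          have e2 := hlip x hx y hy t ht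
          have e3 : ‖fderiv ℝ v (β (x, 1) t).1
              ((β (y, 1) t).1 - (β (x, 1) t).1 - (β (x, 1) t).2 (y - x))‖ ≤
              K * ‖(β (y, 1) t).1 - (β (x, 1) t).1 - (β (x, 1) t).2 (y - x)‖ :=
            (ContinuousLinearMap.le_opNorm _ _).trans
              (by gcongr; exact hKn _ (hαs x hx t ht))
          have e4 : (C : ℝ) * ‖(β (y, 1) t).1 - (β (x, 1) t).1‖ *
              ‖(β (y, 1) t).1 - (β (x, 1) t).1‖ ≤ δ := by
            calc (C : ℝ) * ‖(β (y, 1) t).1 - (β (x, 1) t).1‖ *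
                  ‖(β (y, 1) t).1 - (β (x, 1) t).1‖
                ≤ C * (Real.exp (K * ε) * ‖y - x‖) * (Real.exp (K * ε) * ‖y - x‖) := by gcongr
              _ = δ := by rw [hδ]; ring
          refine le_trans (le_of_eq ?_) ((norm_add_le _ _).trans (add_le_add e3 (e1.trans e4)))
          congr 1
          simp only [map_sub, ContinuousLinearMap.comp_apply, map_zero, add_zero]
          abel) ht
      have h2 : ‖(β (y, 1) 0).1 - (β (x, 1) 0).1 - (β (x, 1) 0).2 (y - x)‖ = 0 := by
        simp [h0 x hx, h0 y hy]
      rw [h2] at h1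
      refine h1.trans ((gronwallBound_mono le_rfl hδ0 K.coe_nonneg (abs_lt.2 ⟨ht.1, ht.2⟩).le).trans
        (le_of_eq ?_))
      rw [gronwallBound_zero_eq_mul, hQ, hδ, hG]
      ring
    have hO : (fun y => (β (y, 1) t).1 - (β (x, 1) t).1 - (β (x, 1) t).2 (y - x))
        =O[𝓝 x] fun y => ‖y - x‖ ^ 2 := by
      refine Asymptotics.IsBigO.of_bound Q ?_
      filter_upwards [Metric.isOpen_ball.mem_nhds hx] with y hy
      simpa using hest y hy
    refine HasFDerivAt.of_isLittleO (hO.trans_isLittleO ?_)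
    have hx0 : Filter.Tendsto (fun y => y - x) (𝓝 x) (𝓝 0) := by
      simpa using (continuous_sub_right x).tendsto x
    exact (Asymptotics.isLittleO_norm_pow_id (E' := F) one_lt_two).comp_tendsto hx0

end ODE

/-! ### Flows on manifolds and the derivative of the adjoint action -/

section Flow
variable {E : Type*} [NormedAddCommGroup E] [NormedSpace ℝ E]
  {M : Type*} [TopologicalSpace M] [ChartedSpace E M] [IsManifold 𝓘(ℝ, E) ∞ M]

theorem flow_zero {X : SmoothVF E M} (hX : IsCompleteVF X) (m : M) : flow X 0 m = m := by
  have h := (hX m).choose_spec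
  simp only [flow, dif_pos (hX m)]
  exact h.1

theorem isMIntegralCurve_flow {X : SmoothVF E M} (hX : IsCompleteVF X) (m : M) :
    IsMIntegralCurve (fun t => flow X t m) (fun x => X x) := by
  have h := (hX m).choose_spec
  simp only [flow, dif_pos (hX m)]
  exact h.2

theorem adFlow_add_right (X Y Z : SmoothVF E M) (s : ℝ) (m : M) :
    adFlow X s (Y + Z) m = adFlow X s Y m + adFlow X s Z m :=
  map_add (mfderiv 𝓘(ℝ, E) 𝓘(ℝ, E) (flow X s) (flow X (-s) m)) _ _

theorem adFlow_smul_right (X : SmoothVF E M) (c : ℝ) (Y : SmoothVF E M) (s : ℝ) (m : M) :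
    adFlow X s (c • Y) m = c • adFlow X s Y m :=
  map_smul (mfderiv 𝓘(ℝ, E) 𝓘(ℝ, E) (flow X s) (flow X (-s) m)) c _

theorem eqOn_flow [T2Space M] {X : SmoothVF E M} (hX : IsCompleteVF X) {γ : ℝ → M} {ε : ℝ}
    (hε : 0 < ε) (hγ : IsMIntegralCurveOn γ (fun x => X x) (Ioo (-ε) ε)) :
    EqOn γ (fun t => flow X t (γ 0)) (Ioo (-ε) ε) :=
  isMIntegralCurveOn_Ioo_eqOn_of_contMDiff_boundaryless (t₀ := 0) ⟨by linarith, hε⟩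
    (X.contMDiff.of_le (by simp)) hγ ((isMIntegralCurve_flow hX _).isMIntegralCurveOn _)
    (flow_zero hX _).symm

theorem flow_add [T2Space M] {X : SmoothVF E M} (hX : IsCompleteVF X) (s t : ℝ) (m : M) :
    flow X (s + t) m = flow X s (flow X t m) := by
  have heq := isMIntegralCurve_Ioo_eq_of_contMDiff_boundaryless (t₀ := 0)
    (X.contMDiff.of_le (by simp)) ((isMIntegralCurve_flow hX m).comp_add t)
    (isMIntegralCurve_flow hX (flow X t m)) (by simp [flow_zero hX])
  exact congrFun heq s

theorem adFlow_zero {X : SmoothVF E M} (hX : IsCompleteVF X) (Y : SmoothVF E M) (m : M) :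
    adFlow X 0 Y m = Y m := by
  have key : ∀ (f : M → M) (y : M), f = id → y = m →
      (mfderiv 𝓘(ℝ, E) 𝓘(ℝ, E) f y (Y y) : E) = (Y m : E) := by
    rintro f y rfl rfl
    rw [mfderiv_id]
    rfl
  exact key _ _ (funext fun y => flow_zero hX y) (by rw [neg_zero, flow_zero hX])

/-- The representative of a vector field in the preferred chart at `x₀`. -/
def chartRep (x₀ : M) (X : SmoothVF E M) : E → E :=
  VectorField.mpullbackWithin 𝓘(ℝ, E) 𝓘(ℝ, E) (extChartAt 𝓘(ℝ, E) x₀).symm X (range 𝓘(ℝ, E))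

theorem mfderiv_extChartAt_symm_chartRep {x₀ : M} (X : SmoothVF E M) {y : E}
    (hy : y ∈ (extChartAt 𝓘(ℝ, E) x₀).target) :
    mfderiv 𝓘(ℝ, E) 𝓘(ℝ, E) (extChartAt 𝓘(ℝ, E) x₀).symm y (chartRep x₀ X y : E) =
      X ((extChartAt 𝓘(ℝ, E) x₀).symm y) := by
  have hinv := isInvertible_mfderivWithin_extChartAt_symm (I := 𝓘(ℝ, E)) (x := x₀) hy
  simp only [chartRep, VectorField.mpullbackWithin_apply]
  rw [modelWithCornersSelf_coe, range_id, mfderivWithin_univ] at hinv ⊢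
  obtain ⟨e, he⟩ := hinv
  rw [← he, ContinuousLinearMap.inverse_equiv]
  erw [ContinuousLinearEquiv.apply_symm_apply]

theorem chartRep_extChartAt {x₀ x : M} (X : SmoothVF E M)
    (hx : x ∈ (extChartAt 𝓘(ℝ, E) x₀).source) :
    chartRep x₀ X (extChartAt 𝓘(ℝ, E) x₀ x) =
      mfderiv 𝓘(ℝ, E) 𝓘(ℝ, E) (extChartAt 𝓘(ℝ, E) x₀) x (X x) := by
  have hy := (extChartAt 𝓘(ℝ, E) x₀).map_source hx
  have h1 := mfderiv_extChartAt_symm_chartRep X hy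
  have h2 := mfderiv_extChartAt_comp_mfderivWithin_extChartAt_symm (I := 𝓘(ℝ, E)) hy
  rw [(extChartAt 𝓘(ℝ, E) x₀).left_inv hx] at h1 h2
  rw [modelWithCornersSelf_coe, range_id, mfderivWithin_univ] at h2
  rw [← h1]
  exact (congrArg (fun L : E →L[ℝ] E => L _) h2).symm

/-- Solutions of the equation in a chart are integral curves on the manifold. -/
theorem hasMFDerivAt_extChartAt_symm_comp {x₀ : M} {X : SmoothVF E M} {α : ℝ → E} {t : ℝ}
    (hα : HasDerivAt α (chartRep x₀ X (α t)) t) (ht : α t ∈ (extChartAt 𝓘(ℝ, E) x₀).target) :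
    HasMFDerivAt 𝓘(ℝ, ℝ) 𝓘(ℝ, E) (fun t => (extChartAt 𝓘(ℝ, E) x₀).symm (α t)) t
      ((1 : ℝ →L[ℝ] ℝ).smulRight (X ((extChartAt 𝓘(ℝ, E) x₀).symm (α t)))) := by
  have hs := mdifferentiableWithinAt_extChartAt_symm (I := 𝓘(ℝ, E)) (x := x₀) ht
  rw [modelWithCornersSelf_coe, range_id, mdifferentiableWithinAt_univ] at hs
  have h1 : HasMFDerivAt 𝓘(ℝ, ℝ) 𝓘(ℝ, E) α t
      ((1 : ℝ →L[ℝ] ℝ).smulRight (chartRep x₀ X (α t)) : ℝ →L[ℝ] E) :=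
    hasMFDerivAt_iff_hasFDerivAt.2 hα.hasFDerivAt
  have h := HasMFDerivAt.comp t hs.hasMFDerivAt h1
  refine h.congr_mfderiv (ContinuousLinearMap.ext_ring ?_)
  have h2 := mfderiv_extChartAt_symm_chartRep X ht
  change mfderiv 𝓘(ℝ, E) 𝓘(ℝ, E) (extChartAt 𝓘(ℝ, E) x₀).symm (α t)
    ((1 : ℝ) • chartRep x₀ X (α t) : E) = (1 : ℝ) • X ((extChartAt 𝓘(ℝ, E) x₀).symm (α t))
  rw [one_smul, one_smul]
  exact h2

variable [CompleteSpace E]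

theorem contDiffAt_chartRep (x₀ : M) (X : SmoothVF E M) :
    ContDiffAt ℝ ∞ (chartRep x₀ X) (extChartAt 𝓘(ℝ, E) x₀ x₀) := by
  have h1 := VectorField.contMDiffWithinAt_mpullbackWithin_extChartAt_symm (I := 𝓘(ℝ, E))
    (n := ∞) (m := ∞) (s := univ) (x := x₀) X.contMDiff.contMDiffAt.contMDiffWithinAt
    uniqueMDiffOn_univ (mem_univ _) (by simp)
  have h2 := contMDiffWithinAt_vectorSpace_iff_contDiffWithinAt.1 h1
  rw [preimage_univ, inter_univ] at h2
  exact h2.contDiffAt (extChartAt_target_mem_nhds x₀)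

theorem vfBracket_apply (X Y : SmoothVF E M) (x : M) :
    vfBracket X Y x = VectorField.lieBracket ℝ (chartRep x X) (chartRep x Y)
      (extChartAt 𝓘(ℝ, E) x x) := by
  change VectorField.mlieBracket 𝓘(ℝ, E) X Y x = _
  rw [VectorField.mlieBracket, VectorField.mlieBracketWithin_apply, mfderiv_extChartAt_self]
  refine (congrArg (fun L : E →L[ℝ] E => L _) ContinuousLinearMap.inverse_id).trans ?_
  simp only [chartRep, preimage_univ, modelWithCornersSelf_coe, range_id, inter_univ]
  exact congrFun (VectorField.lieBracketWithin_univ (𝕜 := ℝ) (E := E)) _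

/-- The flow of a complete vector field near a point `x₀`, read in the chart at `x₀`: it is the
local flow `α` of the representative of the field, with space derivative `D`. -/
theorem exists_flow_eq_extChartAt_symm [T2Space M] {X : SmoothVF E M} (hX : IsCompleteVF X)
    (x₀ : M) :
    ∃ (α : E → ℝ → E) (D : E → ℝ → E →L[ℝ] E) (ε : ℝ), 0 < ε ∧ ∀ᶠ x in 𝓝 x₀,
      x ∈ (extChartAt 𝓘(ℝ, E) x₀).source ∧ D (extChartAt 𝓘(ℝ, E) x₀ x) 0 = 1 ∧
      HasDerivAt (D (extChartAt 𝓘(ℝ, E) x₀ x))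
        (fderiv ℝ (chartRep x₀ X) (extChartAt 𝓘(ℝ, E) x₀ x)) 0 ∧
      ∀ t ∈ Ioo (-ε) ε,
        HasDerivAt (α (extChartAt 𝓘(ℝ, E) x₀ x))
          (chartRep x₀ X (α (extChartAt 𝓘(ℝ, E) x₀ x) t)) t ∧
        α (extChartAt 𝓘(ℝ, E) x₀ x) t ∈ (extChartAt 𝓘(ℝ, E) x₀).target ∧
        flow X t x = (extChartAt 𝓘(ℝ, E) x₀).symm (α (extChartAt 𝓘(ℝ, E) x₀ x) t) ∧
        HasFDerivAt (fun y => α y t) (D (extChartAt 𝓘(ℝ, E) x₀ x) t)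
          (extChartAt 𝓘(ℝ, E) x₀ x) := by
  obtain ⟨α, D, r, ε, hr, hε, h⟩ := exists_localFlow_hasFDerivAt
    ((contDiffAt_chartRep x₀ X).of_le (WithTop.coe_le_coe.2 le_top))
    (extChartAt_target_mem_nhds (I := 𝓘(ℝ, E)) x₀)
  refine ⟨α, D, ε, hε, ?_⟩
  filter_upwards [extChartAt_source_mem_nhds (I := 𝓘(ℝ, E)) x₀,
    (continuousAt_extChartAt (I := 𝓘(ℝ, E)) x₀).preimage_mem_nhds (Metric.ball_mem_nhds _ hr)]
    with x hx hxr
  obtain ⟨h0, hD0, hD, ht⟩ := h _ hxr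
  refine ⟨hx, hD0, hD, fun t htε => ⟨(ht t htε).1, (ht t htε).2.1, ?_, (ht t htε).2.2⟩⟩
  have heq := eqOn_flow hX hε (fun t htε =>
    (hasMFDerivAt_extChartAt_symm_comp (ht t htε).1 (ht t htε).2.1).hasMFDerivWithinAt) htε
  simp only [h0, (extChartAt 𝓘(ℝ, E) x₀).left_inv hx] at heq
  exact heq.symm

theorem eventually_mdifferentiableAt_flow [T2Space M] {X : SmoothVF E M} (hX : IsCompleteVF X)
    (x₀ : M) :
    ∃ ε > 0, ∀ᶠ x in 𝓝 x₀, ∀ t ∈ Ioo (-ε) ε,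
      MDifferentiableAt 𝓘(ℝ, E) 𝓘(ℝ, E) (flow X t) x := by
  obtain ⟨α, D, ε, hε, h⟩ := exists_flow_eq_extChartAt_symm hX x₀
  refine ⟨ε, hε, ?_⟩
  filter_upwards [h.eventually_nhds] with x hx t ht
  have heq : flow X t =ᶠ[𝓝 x]
      (extChartAt 𝓘(ℝ, E) x₀).symm ∘ (fun y => α y t) ∘ extChartAt 𝓘(ℝ, E) x₀ :=
    hx.mono fun y hy => (hy.2.2.2 t ht).2.2.1
  obtain ⟨hxs, -, -, hxt⟩ := hx.self_of_nhds
  obtain ⟨-, htar, -, hfd⟩ := hxt t ht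
  have hs := mdifferentiableWithinAt_extChartAt_symm (I := 𝓘(ℝ, E)) (x := x₀) htar
  rw [modelWithCornersSelf_coe, range_id, mdifferentiableWithinAt_univ] at hs
  rw [extChartAt_source] at hxs
  refine MDifferentiableAt.congr_of_eventuallyEq ?_ heq
  exact hs.comp x (hfd.differentiableAt.mdifferentiableAt.comp x
    (mdifferentiableAt_extChartAt hxs))

/-- Every map `e^{tX}` is differentiable. The set of times at which `e^{tX}` is differentiable at
`x` is clopen, since locally around a point of the orbit all `e^{tX}` with small `t` are
differentiable. -/
theorem mdifferentiableAt_flow [T2Space M] {X : SmoothVF E M} (hX : IsCompleteVF X) (t : ℝ)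
    (x : M) : MDifferentiableAt 𝓘(ℝ, E) 𝓘(ℝ, E) (flow X t) x := by
  set S : Set ℝ := {t | MDifferentiableAt 𝓘(ℝ, E) 𝓘(ℝ, E) (flow X t) x} with hS
  have hloc : ∀ t₀ : ℝ, ∀ᶠ t in 𝓝 t₀, (t ∈ S ↔ t₀ ∈ S) := by
    intro t₀
    obtain ⟨ε, hε, h⟩ := eventually_mdifferentiableAt_flow hX (flow X t₀ x)
    have hcont : ContinuousAt (fun t => flow X t x) t₀ :=
      (isMIntegralCurve_flow hX x).continuous.continuousAt
    filter_upwards [hcont.eventually h, Ioo_mem_nhds (show t₀ - ε < t₀ by linarith)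
      (show t₀ < t₀ + ε by linarith)] with t ht htI
    have hstep : ∀ a b : ℝ, MDifferentiableAt 𝓘(ℝ, E) 𝓘(ℝ, E) (flow X (b - a)) (flow X a x) →
        a ∈ S → b ∈ S := by
      intro a b h1 h2
      have h3 : flow X b = flow X (b - a) ∘ flow X a := by
        funext y
        rw [Function.comp_apply, ← flow_add hX, sub_add_cancel]
      change MDifferentiableAt 𝓘(ℝ, E) 𝓘(ℝ, E) (flow X b) x
      rw [h3]
      exact MDifferentiableAt.comp x h1 h2
    exact ⟨hstep t t₀ (ht _ ⟨by linarith [htI.2], by linarith [htI.1]⟩),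
      hstep t₀ t (h.self_of_nhds _ ⟨by linarith [htI.1], by linarith [htI.2]⟩)⟩
  have hclopen : IsClopen S := by
    constructor
    · rw [← isOpen_compl_iff, isOpen_iff_mem_nhds]
      intro t₀ ht₀
      filter_upwards [hloc t₀] with t ht using fun h => ht₀ (ht.1 h)
    · rw [isOpen_iff_mem_nhds]
      intro t₀ ht₀
      filter_upwards [hloc t₀] with t ht using ht.2 ht₀
  have hne : S.Nonempty := by
    refine ⟨0, ?_⟩
    have h0 : flow X 0 = id := funext fun y => flow_zero hX y
    change MDifferentiableAt 𝓘(ℝ, E) 𝓘(ℝ, E) (flow X 0) x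
    rw [h0]
    exact mdifferentiableAt_id
  have : t ∈ S := by rw [hclopen.eq_univ hne]; trivial
  exact this

theorem mfderiv_flow_comp_mfderiv_flow [T2Space M] {X : SmoothVF E M} (hX : IsCompleteVF X)
    (s t : ℝ) (x : M) (w : E) :
    mfderiv 𝓘(ℝ, E) 𝓘(ℝ, E) (flow X s) (flow X t x)
      (mfderiv 𝓘(ℝ, E) 𝓘(ℝ, E) (flow X t) x w) =
      mfderiv 𝓘(ℝ, E) 𝓘(ℝ, E) (flow X (s + t)) x w := by
  have h : flow X (s + t) = flow X s ∘ flow X t := funext fun y => flow_add hX s t y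
  rw [h, mfderiv_comp x (mdifferentiableAt_flow hX s _) (mdifferentiableAt_flow hX t x)]
  rfl

/-- The group property of the flow, in the form that reduces the derivative of `s ↦ Ad_{e^{sX}} Y`
to its derivative at `0`. -/
theorem adFlow_add [T2Space M] {X : SmoothVF E M} (hX : IsCompleteVF X) (Y : SmoothVF E M)
    (s h : ℝ) (m : M) :
    adFlow X (s + h) Y m =
      mfderiv 𝓘(ℝ, E) 𝓘(ℝ, E) (flow X s) (flow X (-s) m) (adFlow X h Y (flow X (-s) m)) := by
  have h1 : flow X (-(s + h)) m = flow X (-h) (flow X (-s) m) := by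
    rw [← flow_add hX]; congr 1; ring
  have h2 := mfderiv_flow_comp_mfderiv_flow hX s h (flow X (-h) (flow X (-s) m))
    (Y (flow X (-h) (flow X (-s) m)))
  rw [flow_flow_neg hX] at h2
  simp only [adFlow]
  rw [h1]
  exact h2.symm

/-- `d/ds Ad_{e^{sX}} Y = -[X, Y]` at `s = 0`. In the chart at `m`, `Ad_{e^{hX}} Y` is
`(D_{-h})⁻¹ w(α_{-h})`, where `w` represents `Y` and `D_t` is the space derivative of the flow
`α_t`. -/
theorem hasDerivAt_adFlow_zero [T2Space M] {X : SmoothVF E M} (hX : IsCompleteVF X)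
    (Y : SmoothVF E M) (m : M) :
    HasDerivAt (F := E) (fun s => adFlow X s Y m) (-(vfBracket X Y m : E)) 0 := by
  obtain ⟨α, D, ε, hε, h⟩ := exists_flow_eq_extChartAt_symm hX m
  set φ := extChartAt 𝓘(ℝ, E) m with hφ
  set p := φ m with hp
  set v := chartRep m X with hv
  set w := chartRep m Y with hw
  obtain ⟨hms, hD0, hD, hm⟩ := h.self_of_nhds
  rw [← hp] at hD0 hD hm
  have h0 : (0 : ℝ) ∈ Ioo (-ε) ε := ⟨by linarith, hε⟩
  have hα0 : α p 0 = p := by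
    have h1 := (hm 0 h0).2.2.1
    rw [flow_zero hX] at h1
    rw [hp]
    conv_rhs => rw [h1]
    exact (φ.right_inv (hm 0 h0).2.1).symm
  have hnegε : ∀ᶠ s : ℝ in 𝓝 0, -s ∈ Ioo (-ε) ε := by
    filter_upwards [Ioo_mem_nhds h0.1 h0.2] with s hs
    exact ⟨by linarith [hs.2], by linarith [hs.1]⟩
  have hDneg : HasDerivAt (fun s => D p (-s)) (-fderiv ℝ v p) 0 := by
    have h1 : HasDerivAt (D p) (fderiv ℝ v p) (-0) := by rw [neg_zero]; exact hD
    have := h1.scomp (0 : ℝ) (hasDerivAt_neg 0)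
    rw [neg_one_smul] at this
    exact this
  have hunit : ∀ᶠ s : ℝ in 𝓝 0, IsUnit (D p (-s)) := by
    have h1 : {u : E →L[ℝ] E | IsUnit u} ∈ 𝓝 (D p (-0)) := by
      rw [neg_zero, hD0]
      exact Units.isOpen.mem_nhds isUnit_one
    exact hDneg.continuousAt.preimage_mem_nhds h1
  -- the formula in the chart
  have hformula : (fun s => (adFlow X s Y m : E)) =ᶠ[𝓝 0]
      fun s => Ring.inverse (D p (-s)) (w (α p (-s))) := by
    filter_upwards [hnegε, hunit] with s hs hu
    obtain ⟨-, htar, hfl, hfd⟩ := hm (-s) hs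
    have hys : flow X (-s) m ∈ φ.source := by rw [hfl]; exact φ.map_target htar
    have hφy : φ (flow X (-s) m) = α p (-s) := by rw [hfl, φ.right_inv htar]
    have hinv : mfderiv 𝓘(ℝ, E) 𝓘(ℝ, E) (flow X (-s)) m (adFlow X s Y m) =
        Y (flow X (-s) m) := by
      have h1 := mfderiv_flow_comp_mfderiv_flow hX (-s) s (flow X (-s) m) (Y (flow X (-s) m))
      rw [flow_flow_neg hX] at h1
      refine h1.trans ?_
      have h0 : flow X (-s + s) = id := funext fun y => by
        rw [neg_add_cancel]; exact flow_zero hX y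
      rw [h0, mfderiv_id]
      rfl
    have heq : φ ∘ flow X (-s) =ᶠ[𝓝 m] (fun y => α y (-s)) ∘ φ := by
      filter_upwards [h] with y hy
      have hy2 := hy.2.2.2 (-s) hs
      rw [Function.comp_apply, hy2.2.2.1, φ.right_inv hy2.2.1]
      rfl
    have hφm : MDifferentiableAt 𝓘(ℝ, E) 𝓘(ℝ, E) φ m :=
      mdifferentiableAt_extChartAt (mem_chart_source E m)
    have hφy' : MDifferentiableAt 𝓘(ℝ, E) 𝓘(ℝ, E) φ (flow X (-s) m) :=
      mdifferentiableAt_extChartAt (by rwa [hφ, extChartAt_source] at hys)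
    have hright : HasMFDerivAt 𝓘(ℝ, E) 𝓘(ℝ, E) ((fun y => α y (-s)) ∘ φ) m
        ((D p (-s)).comp (mfderiv 𝓘(ℝ, E) 𝓘(ℝ, E) φ m)) :=
      HasMFDerivAt.comp m hfd.hasMFDerivAt hφm.hasMFDerivAt
    have hleft := (hφy'.hasMFDerivAt.comp m
      (mdifferentiableAt_flow hX (-s) m).hasMFDerivAt).congr_of_eventuallyEq heq.symm
    have hder := hasMFDerivAt_unique hleft hright
    rw [mfderiv_extChartAt_self] at hder
    have h3 : D p (-s) (adFlow X s Y m) = w (α p (-s)) := by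
      refine (congrArg (fun L : E →L[ℝ] E => L (adFlow X s Y m)) hder).symm.trans ?_
      change mfderiv 𝓘(ℝ, E) 𝓘(ℝ, E) φ (flow X (-s) m)
        (mfderiv 𝓘(ℝ, E) 𝓘(ℝ, E) (flow X (-s)) m (adFlow X s Y m)) = _
      rw [hinv, ← chartRep_extChartAt Y hys, hφy]
    rw [← h3]
    have h4 := congrArg (fun L : E →L[ℝ] E => L (adFlow X s Y m))
      (Ring.inverse_mul_cancel _ hu)
    exact h4.symm
  have hαneg : HasDerivAt (fun s => α p (-s)) (-v p) 0 := by
    have h1 : HasDerivAt (α p) (v p) (-0) := by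
      have := (hm 0 h0).1
      rw [hα0] at this
      rw [neg_zero]; exact this
    have := h1.scomp (0 : ℝ) (hasDerivAt_neg 0)
    rw [neg_one_smul] at this
    exact this
  have hwd : HasFDerivAt w (fderiv ℝ w p) (α p (-0)) := by
    rw [neg_zero, hα0]
    exact ((contDiffAt_chartRep m Y).differentiableAt (by simp)).hasFDerivAt
  have hwα := hwd.comp_hasDerivAt (0 : ℝ) hαneg
  have hinv : HasDerivAt (fun s => Ring.inverse (D p (-s))) (fderiv ℝ v p) 0 := by
    have h1 := hasFDerivAt_ringInverse (𝕜 := ℝ) (1 : (E →L[ℝ] E)ˣ)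
    have h2 : HasFDerivAt (Ring.inverse : (E →L[ℝ] E) → _)
        (-ContinuousLinearMap.mulLeftRight ℝ (E →L[ℝ] E) 1 1) (D p (-0)) := by
      rw [neg_zero, hD0]; simpa using h1
    have h3 := h2.comp_hasDerivAt (0 : ℝ) hDneg
    refine h3.congr_deriv ?_
    simp
  have hfin := (hinv.clm_apply hwα).congr_of_eventuallyEq hformula
  refine hfin.congr_deriv ?_
  rw [vfBracket_apply]
  simp only [Function.comp_apply, neg_zero, hα0, hD0, Ring.inverse_one, map_neg,
    VectorField.lieBracket]
  change fderiv ℝ v p (w p) + (1 : E →L[ℝ] E) (-(fderiv ℝ w p (v p))) = _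
  rw [one_apply_eq_self]
  abel

/-- `d/ds Ad_{e^{sX}} Y = -Ad_{e^{sX}} [X, Y]`. -/
theorem hasDerivAt_adFlow [T2Space M] {X : SmoothVF E M} (hX : IsCompleteVF X)
    (Y : SmoothVF E M) (m : M) (s : ℝ) :
    HasDerivAt (F := E) (fun r => adFlow X r Y m) (-(adFlow X s (vfBracket X Y) m : E)) s := by
  let L : E →L[ℝ] E := mfderiv 𝓘(ℝ, E) 𝓘(ℝ, E) (flow X s) (flow X (-s) m)
  have h0 := hasDerivAt_adFlow_zero hX Y (flow X (-s) m)
  have h1 : HasDerivAt (fun h => L (adFlow X h Y (flow X (-s) m)))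
      (-(adFlow X s (vfBracket X Y) m : E)) (s - s) := by
    rw [sub_self]
    refine (L.hasFDerivAt.comp_hasDerivAt (0 : ℝ) h0).congr_deriv ?_
    exact map_neg L _
  have h2 := h1.comp_sub_const s s
  refine h2.congr_of_eventuallyEq (Filter.Eventually.of_forall fun r => ?_)
  have := adFlow_add hX Y s (r - s) m
  rw [add_sub_cancel] at this
  exact this

end Flow

/-! ### The truncated tensor algebra -/

section TruncatedAlgebra
variable {d : ℕ}

theorem homPart_homPart (i j : ℕ) (x : Tens d) :
    homPart i (homPart j x) = if i = j then homPart j x else 0 := by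
  have hmem : homPart j x ∈ LinearMap.range
      (TensorAlgebra.ι ℝ : EuclideanSpace ℝ (Fin d) →ₗ[ℝ] Tens d) ^ j := SetLike.coe_mem _
  split_ifs with h
  · subst h
    exact DirectSum.decompose_of_mem_same (fun i : ℕ => LinearMap.range
      (TensorAlgebra.ι ℝ : EuclideanSpace ℝ (Fin d) →ₗ[ℝ] Tens d) ^ i) hmem
  · exact DirectSum.decompose_of_mem_ne (fun i : ℕ => LinearMap.range
      (TensorAlgebra.ι ℝ : EuclideanSpace ℝ (Fin d) →ₗ[ℝ] Tens d) ^ i) hmem (Ne.symm h)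

theorem homPart_trunc (κ k : ℕ) (x : Tens d) :
    homPart k (trunc κ x) = if k ≤ κ then homPart k x else 0 := by
  simp only [trunc, LinearMap.sum_apply, map_sum, homPart_homPart, Finset.sum_ite_eq,
    Finset.mem_range, Nat.lt_succ_iff]

theorem trunc_trunc (κ : ℕ) (x : Tens d) : trunc κ (trunc κ x) = trunc κ x := by
  have h : ∀ y : Tens d, trunc κ y = ∑ k ∈ Finset.range (κ + 1), homPart k y := fun y => by
    rw [trunc, LinearMap.sum_apply]
  rw [h (trunc κ x), h x]
  refine Finset.sum_congr rfl fun k hk => ?_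
  rw [← h, homPart_trunc, if_pos (Nat.lt_succ_iff.1 (Finset.mem_range.1 hk))]

/-- The tensors all of whose components of degree `< n` vanish. -/
def degGE (d n : ℕ) : Submodule ℝ (Tens d) := ⨅ k : Fin n, LinearMap.ker (homPart (d := d) k)

theorem mem_degGE {n : ℕ} {x : Tens d} : x ∈ degGE d n ↔ ∀ k < n, homPart k x = 0 := by
  simp only [degGE, Submodule.mem_iInf, LinearMap.mem_ker]
  exact ⟨fun h k hk => h ⟨k, hk⟩, fun h k => h k k.2⟩

theorem degGE_anti {m n : ℕ} (h : m ≤ n) : degGE d n ≤ degGE d m := fun _ hx =>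
  mem_degGE.2 fun k hk => mem_degGE.1 hx k (hk.trans_le h)

theorem mem_degGE_zero (x : Tens d) : x ∈ degGE d 0 := mem_degGE.2 fun k hk => by omega

theorem mul_mem_degGE {m n : ℕ} {x y : Tens d} (hx : x ∈ degGE d m) (hy : y ∈ degGE d n) :
    x * y ∈ degGE d (m + n) := by
  classical
  rw [mem_degGE] at *
  intro k hk
  change ((DirectSum.decompose (fun i : ℕ => LinearMap.range
    (TensorAlgebra.ι ℝ : EuclideanSpace ℝ (Fin d) →ₗ[ℝ] Tens d) ^ i) (x * y)) k : Tens d) = 0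
  rw [DirectSum.decompose_mul, DirectSum.coe_mul_apply]
  refine Finset.sum_eq_zero fun ij hij => ?_
  have hsum : ij.1 + ij.2 = k := (Finset.mem_filter.1 hij).2
  change homPart ij.1 x * homPart ij.2 y = 0
  rcases lt_or_ge ij.1 m with h | h
  · rw [hx _ h, zero_mul]
  · rw [hy _ (by omega), mul_zero]

theorem pow_mem_degGE {x : Tens d} (hx : x ∈ degGE d 1) (n : ℕ) : x ^ n ∈ degGE d n := by
  induction n with
  | zero => exact mem_degGE_zero _
  | succ n ih => rw [pow_succ]; exact mul_mem_degGE ih hx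

theorem trunc_eq_zero {κ : ℕ} {x : Tens d} (hx : x ∈ degGE d (κ + 1)) : trunc κ x = 0 := by
  rw [trunc, LinearMap.sum_apply]
  exact Finset.sum_eq_zero fun k hk => mem_degGE.1 hx k (Finset.mem_range.1 hk)

theorem sub_trunc_mem_degGE (κ : ℕ) (x : Tens d) : x - trunc κ x ∈ degGE d (κ + 1) := by
  rw [mem_degGE]
  intro k hk
  rw [map_sub, homPart_trunc, if_pos (Nat.lt_succ_iff.1 hk), sub_self]

theorem trunc_mem_degGE {κ n : ℕ} {x : Tens d} (hx : x ∈ degGE d n) : trunc κ x ∈ degGE d n := by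
  rw [mem_degGE] at *
  intro k hk
  rw [homPart_trunc, hx k hk, ite_self]

theorem trunc_trunc_mul (κ : ℕ) (x y : Tens d) : trunc κ (trunc κ x * y) = trunc κ (x * y) := by
  have h := trunc_eq_zero (κ := κ) (x := (x - trunc κ x) * y)
    (by simpa using mul_mem_degGE (sub_trunc_mem_degGE κ x) (mem_degGE_zero y))
  rw [sub_mul, map_sub, sub_eq_zero] at h
  exact h.symm

theorem trunc_mul_trunc (κ : ℕ) (x y : Tens d) : trunc κ (x * trunc κ y) = trunc κ (x * y) := by
  have h := trunc_eq_zero (κ := κ) (x := x * (y - trunc κ y))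
    (by simpa using mul_mem_degGE (mem_degGE_zero x) (sub_trunc_mem_degGE κ y))
  rw [mul_sub, map_sub, sub_eq_zero] at h
  exact h.symm

theorem brTensor_mem_degGE {m n : ℕ} {x y : Tens d} (hx : x ∈ degGE d m) (hy : y ∈ degGE d n) :
    brTensor x y ∈ degGE d (m + n) :=
  sub_mem (mul_mem_degGE hx hy) (by rw [add_comm]; exact mul_mem_degGE hy hx)

theorem freeNil_le {κ : ℕ} (hκ : 1 ≤ κ) :
    freeNil d κ ≤ degGE d 1 ⊓ LinearMap.eqLocus (trunc κ) LinearMap.id := by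
  refine sInf_le ⟨fun x hx => ?_, fun x hx y hy => ⟨?_, trunc_trunc κ _⟩⟩
  · have hx1 : x ∈ LinearMap.range
        (TensorAlgebra.ι ℝ : EuclideanSpace ℝ (Fin d) →ₗ[ℝ] Tens d) ^ 1 := by
      rw [pow_one]; exact hx
    have h1 : homPart 1 x = x := DirectSum.decompose_of_mem_same (fun i : ℕ => LinearMap.range
      (TensorAlgebra.ι ℝ : EuclideanSpace ℝ (Fin d) →ₗ[ℝ] Tens d) ^ i) hx1
    refine ⟨mem_degGE.2 fun k hk => ?_, ?_⟩
    · rw [← h1, homPart_homPart, if_neg (by omega)]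
    · change trunc κ x = x
      conv_lhs => rw [← h1]
      simp only [trunc, LinearMap.sum_apply, homPart_homPart]
      rw [Finset.sum_ite_eq', if_pos (Finset.mem_range.2 (by omega)), h1]
  · exact trunc_mem_degGE (degGE_anti (by norm_num) (brTensor_mem_degGE hx.1 hy.1))

theorem mem_degGE_of_mem_freeNil {κ : ℕ} (hκ : 1 ≤ κ) {A : Tens d} (hA : A ∈ freeNil d κ) :
    A ∈ degGE d 1 := (freeNil_le hκ hA).1

theorem trunc_of_mem_freeNil {κ : ℕ} (hκ : 1 ≤ κ) {A : Tens d} (hA : A ∈ freeNil d κ) :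
    trunc κ A = A := (freeNil_le hκ hA).2

theorem truncAd_apply (κ : ℕ) (A B : Tens d) : truncAd κ A B = trunc κ (brTensor A B) := rfl

theorem truncAd_smul (κ : ℕ) (c : ℝ) (A : Tens d) : truncAd κ (c • A) = c • truncAd κ A := by
  ext B
  simp only [truncAd_apply, LinearMap.smul_apply, brTensor, smul_mul_assoc, mul_smul_comm,
    ← smul_sub, map_smul]

theorem truncAd_pow_mem_freeNil {κ : ℕ} {A B : Tens d} (hA : A ∈ freeNil d κ)
    (hB : B ∈ freeNil d κ) (k : ℕ) : (truncAd κ A ^ k) B ∈ freeNil d κ := by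
  induction k with
  | zero => simpa using hB
  | succ k ih =>
    rw [pow_succ', Module.End.mul_apply]
    exact br_mem_lieGen hA ih

theorem truncAd_pow_mem_degGE {κ : ℕ} {A B : Tens d} (hA : A ∈ degGE d 1)
    (hB : B ∈ degGE d 1) (k : ℕ) : (truncAd κ A ^ k) B ∈ degGE d (1 + k) := by
  induction k with
  | zero => simpa using hB
  | succ k ih =>
    rw [pow_succ', Module.End.mul_apply, truncAd_apply]
    exact degGE_anti (by omega) (trunc_mem_degGE (brTensor_mem_degGE hA ih))

/-- `ad_A^κ B = 0`, since `ad_A^κ B` has no component of degree `≤ κ`. -/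
theorem truncAd_pow_eq_zero {κ k : ℕ} (hκ : 1 ≤ κ) (hk : κ ≤ k) {A B : Tens d}
    (hA : A ∈ freeNil d κ) (hB : B ∈ freeNil d κ) : (truncAd κ A ^ k) B = 0 := by
  rw [← trunc_of_mem_freeNil hκ (truncAd_pow_mem_freeNil hA hB k)]
  exact trunc_eq_zero (degGE_anti (by omega) (truncAd_pow_mem_degGE
    (mem_degGE_of_mem_freeNil hκ hA) (mem_degGE_of_mem_freeNil hκ hB) k))

/-- Left multiplication by `A` in the truncated algebra. -/
def truncMulLeft (κ : ℕ) (A : Tens d) : Module.End ℝ (Tens d) := trunc κ ∘ₗ LinearMap.mulLeft ℝ A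

/-- Right multiplication by `A` in the truncated algebra. -/
def truncMulRight (κ : ℕ) (A : Tens d) : Module.End ℝ (Tens d) :=
  trunc κ ∘ₗ LinearMap.mulRight ℝ A

theorem truncMulLeft_pow (κ : ℕ) (A x : Tens d) (n : ℕ) :
    trunc κ ((truncMulLeft κ A ^ n) x) = trunc κ (A ^ n * x) := by
  induction n with
  | zero => simp
  | succ n ih =>
    rw [pow_succ', Module.End.mul_apply]
    change trunc κ (trunc κ (A * _)) = _
    rw [trunc_trunc, ← trunc_mul_trunc, ih, trunc_mul_trunc, ← mul_assoc, ← pow_succ']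

theorem truncMulRight_pow (κ : ℕ) (A x : Tens d) (n : ℕ) :
    trunc κ ((truncMulRight κ A ^ n) x) = trunc κ (x * A ^ n) := by
  induction n with
  | zero => simp
  | succ n ih =>
    rw [pow_succ', Module.End.mul_apply]
    change trunc κ (trunc κ (_ * A)) = _
    rw [trunc_trunc, ← trunc_trunc_mul, ih, trunc_trunc_mul, mul_assoc, ← pow_succ]

theorem trunc_truncMulLeft_pow_succ (κ : ℕ) (A x : Tens d) (n : ℕ) :
    trunc κ ((truncMulLeft κ A ^ (n + 1)) x) = (truncMulLeft κ A ^ (n + 1)) x := by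
  rw [pow_succ', Module.End.mul_apply]
  exact trunc_trunc κ _

theorem trunc_truncMulRight_pow_succ (κ : ℕ) (A x : Tens d) (n : ℕ) :
    trunc κ ((truncMulRight κ A ^ (n + 1)) x) = (truncMulRight κ A ^ (n + 1)) x := by
  rw [pow_succ', Module.End.mul_apply]
  exact trunc_trunc κ _

theorem truncMulLeft_pow_eq_zero {κ : ℕ} {A : Tens d} (hA : A ∈ degGE d 1) :
    truncMulLeft κ A ^ (κ + 1) = 0 := by
  refine LinearMap.ext fun x => ?_
  rw [← trunc_truncMulLeft_pow_succ, truncMulLeft_pow]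
  exact trunc_eq_zero (by simpa using mul_mem_degGE (pow_mem_degGE hA (κ + 1)) (mem_degGE_zero x))

theorem truncMulRight_pow_eq_zero {κ : ℕ} {A : Tens d} (hA : A ∈ degGE d 1) :
    truncMulRight κ A ^ (κ + 1) = 0 := by
  refine LinearMap.ext fun x => ?_
  rw [← trunc_truncMulRight_pow_succ, truncMulRight_pow]
  exact trunc_eq_zero (by simpa using mul_mem_degGE (mem_degGE_zero x) (pow_mem_degGE hA (κ + 1)))

theorem commute_truncMulLeft_truncMulRight (κ : ℕ) (A B : Tens d) :
    Commute (truncMulLeft κ A) (truncMulRight κ B) := by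
  refine LinearMap.ext fun x => ?_
  change trunc κ (A * trunc κ (x * B)) = trunc κ (trunc κ (A * x) * B)
  rw [trunc_mul_trunc, trunc_trunc_mul, mul_assoc]

theorem truncAd_eq_add (κ : ℕ) (A : Tens d) :
    truncAd κ A = truncMulLeft κ A + truncMulRight κ (-A) := by
  refine LinearMap.ext fun x => ?_
  change trunc κ (A * x - x * A) = trunc κ (A * x) + trunc κ (x * -A)
  rw [← map_add, mul_neg, sub_eq_add_neg]

/-- `Ad_{e^A} = e^{ad_A}` on `F^{(κ)}(ℝ^d)`: left and right multiplications commute, so that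
`e^{ad_A}` is the product of the exponentials of the left multiplication by `A` and of the right
multiplication by `-A`. -/
theorem truncAdExp_eq_sum {κ : ℕ} (hκ : 1 ≤ κ) {A B : Tens d} (hA : A ∈ freeNil d κ)
    (hB : B ∈ freeNil d κ) :
    truncAdExp κ A B =
      ∑ k ∈ Finset.range κ, ((k.factorial : ℝ)⁻¹) • (truncAd κ A ^ k) B := by
  have hsmul : ∀ (n : ℕ) (f : Module.End ℝ (Tens d)) (x : Tens d),
      ((n.factorial : ℚ)⁻¹ • f) x = ((n.factorial : ℝ)⁻¹) • f x := by
    intro n f x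
    rw [inv_natCast_smul_eq ℚ ℝ, LinearMap.smul_apply]
  have hA1 := mem_degGE_of_mem_freeNil hκ hA
  have hL := truncMulLeft_pow_eq_zero (κ := κ) hA1
  have hR := truncMulRight_pow_eq_zero (κ := κ) (neg_mem hA1)
  have hcomm := commute_truncMulLeft_truncMulRight κ A (-A)
  have hexp := IsNilpotent.exp_add_of_commute hcomm ⟨_, hL⟩ ⟨_, hR⟩
  obtain ⟨N, hN⟩ := hcomm.isNilpotent_add ⟨_, hL⟩ ⟨_, hR⟩
  rw [← truncAd_eq_add] at hexp hN
  have hN' : truncAd κ A ^ (N + κ) = 0 := pow_eq_zero_of_le (by omega) hN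
  have hlhs : IsNilpotent.exp (truncAd κ A) B =
      ∑ k ∈ Finset.range κ, ((k.factorial : ℝ)⁻¹) • (truncAd κ A ^ k) B := by
    rw [IsNilpotent.exp_eq_sum hN', LinearMap.sum_apply]
    simp only [hsmul]
    refine (Finset.sum_subset (Finset.range_mono (by omega)) fun k _ hk => ?_).symm
    rw [truncAd_pow_eq_zero hκ (by simpa using hk) hA hB, smul_zero]
  have hleft : ∀ x : Tens d, trunc κ x = x →
      IsNilpotent.exp (truncMulLeft κ A) x = trunc κ (truncExp κ A * x) := by
    intro x hx
    rw [IsNilpotent.exp_eq_sum hL, LinearMap.sum_apply, truncExp, trunc_trunc_mul, Finset.sum_mul,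
      map_sum]
    refine Finset.sum_congr rfl fun k _ => ?_
    rw [hsmul, smul_mul_assoc, map_smul, ← truncMulLeft_pow]
    cases k with
    | zero => simp [hx]
    | succ k => rw [trunc_truncMulLeft_pow_succ]
  have hright : ∀ x : Tens d, trunc κ x = x →
      IsNilpotent.exp (truncMulRight κ (-A)) x = trunc κ (x * truncExp κ (-A)) := by
    intro x hx
    rw [IsNilpotent.exp_eq_sum hR, LinearMap.sum_apply, truncExp, trunc_mul_trunc, Finset.mul_sum,
      map_sum]
    refine Finset.sum_congr rfl fun k _ => ?_
    rw [hsmul, mul_smul_comm, map_smul, ← truncMulRight_pow]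
    cases k with
    | zero => simp [hx]
    | succ k => rw [trunc_truncMulRight_pow_succ]
  rw [← hlhs, hexp, Module.End.mul_apply, hright B (trunc_of_mem_freeNil hκ hB),
    hleft _ (trunc_trunc κ _), trunc_mul_trunc, truncAdExp, mul_assoc]

theorem nilpEval_psi_apply (κ : ℕ) (c : ℝ) (L : Module.End ℝ (Tens d)) (B : Tens d) :
    nilpEval κ psi (c • L) B =
      ∑ k ∈ Finset.range κ, (c ^ k * ((k + 1).factorial : ℝ)⁻¹) • (L ^ k) B := by
  simp only [nilpEval, LinearMap.sum_apply, LinearMap.smul_apply, psi, PowerSeries.coeff_mk,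
    smul_pow, smul_smul, mul_comm]

/-- `∫₀¹ Ad_{e^{-sA}} B ds = ψ(-ad_A) B`. -/
theorem hasIntegral01_truncAdExp {κ : ℕ} (hκ : 1 ≤ κ) {A B : Tens d} (hA : A ∈ freeNil d κ)
    (hB : B ∈ freeNil d κ) :
    HasIntegral01 (fun s : ℝ => truncAdExp κ ((-s) • A) B) (nilpEval κ psi (-truncAd κ A) B) := by
  intro l
  have hl : (fun s : ℝ => l (truncAdExp κ ((-s) • A) B)) = fun s : ℝ =>
      ∑ k ∈ Finset.range κ,
        ((k.factorial : ℝ)⁻¹ * (-1) ^ k * l ((truncAd κ A ^ k) B)) * s ^ k := by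
    funext s
    rw [truncAdExp_eq_sum hκ (Submodule.smul_mem _ _ hA) hB, map_sum]
    refine Finset.sum_congr rfl fun k _ => ?_
    rw [truncAd_smul, smul_pow, LinearMap.smul_apply, map_smul, map_smul, neg_pow, smul_eq_mul,
      smul_eq_mul]
    ring
  have hcont : ∀ k : ℕ, Continuous fun s : ℝ =>
      ((k.factorial : ℝ)⁻¹ * (-1) ^ k * l ((truncAd κ A ^ k) B)) * s ^ k := fun k => by fun_prop
  rw [hl]
  refine ⟨(continuous_finsetSum _ fun k _ => hcont k).intervalIntegrable _ _, ?_⟩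
  rw [intervalIntegral.integral_finsetSum fun k _ => (hcont k).intervalIntegrable _ _,
    ← neg_one_smul ℝ (truncAd κ A), nilpEval_psi_apply, map_sum]
  refine Finset.sum_congr rfl fun k _ => ?_
  rw [intervalIntegral.integral_const_mul, integral_pow, map_smul, smul_eq_mul,
    Nat.factorial_succ]
  push_cast
  have h1 : (k.factorial : ℝ) ≠ 0 := by positivity
  have h2 : (k : ℝ) + 1 ≠ 0 := by positivity
  field_simp
  simp

end TruncatedAlgebra

/-! ### The extension of a dynamical system to the free Lie algebra -/

section Extension
variable {E : Type*} [NormedAddCommGroup E] [NormedSpace ℝ E]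
  {M : Type*} [TopologicalSpace M] [T2Space M] [ChartedSpace E M] [IsManifold 𝓘(ℝ, E) ∞ M]
  {d κ : ℕ}

/-- `κ`-completeness, applied to the straight lines `ξ(t) = tA`, gives integral curves of `V_A`
through every point on a time interval of fixed length; hence `V_A` is complete. -/
theorem IsKappaComplete.isCompleteVF {T : ℝ} {V : DynSys E M d} (hV : IsKappaComplete κ T V)
    (hT : 0 < T) {A : Tens d} (hA : A ∈ freeNil d κ) : IsCompleteVF (extVF V A) := by
  have hξ : IsC1On T (fun t : ℝ => t • A) (fun _ => A) := by
    intro l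
    refine ⟨fun t _ => ?_, continuousOn_const⟩
    simp only [map_smul]
    simpa using ((hasDerivAt_id t).smul_const (l A)).hasDerivWithinAt
  have hc := hV _ _ (fun t _ => Submodule.smul_mem _ t hA) hξ
  refine exists_isMIntegralCurve_of_isMIntegralCurveOn ((extVF V A).contMDiff.of_le (by simp))
    (half_pos hT) fun m => ?_
  obtain ⟨σ, hσ0, hσ⟩ := hc (T / 2) ⟨by linarith, by linarith⟩ m
  have hcurve : IsMIntegralCurveOn σ (fun x => extVF V A x) (Icc 0 T) := hσ
  refine ⟨σ ∘ (· + T / 2), by simpa using hσ0, (hcurve.comp_add (T / 2)).mono fun t ht => ?_⟩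
  exact ⟨by linarith [ht.1], by linarith [ht.2]⟩

variable [FiniteDimensional ℝ E] [CompleteSpace E]

theorem extVF_add (V : DynSys E M d) {A B : Tens d} (hA : A ∈ freeLie d) (hB : B ∈ freeLie d) :
    extVF V (A + B) = extVF V A + extVF V B := by
  apply vfOp_injective
  rw [vfOp_extVF V (add_mem hA hB), map_add, ← vfOp_extVF V hA, ← vfOp_extVF V hB]
  exact (map_add vfOpL _ _).symm

theorem extVF_smul (V : DynSys E M d) (c : ℝ) {A : Tens d} (hA : A ∈ freeLie d) :
    extVF V (c • A) = c • extVF V A := by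
  apply vfOp_injective
  rw [vfOp_extVF V (Submodule.smul_mem _ c hA), map_smul, ← vfOp_extVF V hA]
  exact (map_smul vfOpL _ _).symm

theorem vfBracket_extVF (V : DynSys E M d) {A B : Tens d} (hA : A ∈ freeLie d)
    (hB : B ∈ freeLie d) :
    vfBracket (extVF V A) (extVF V B) = extVF V (brTensor A B) := by
  apply vfOp_injective
  rw [vfOp_bracket, vfOp_extVF V hA, vfOp_extVF V hB, vfOp_extVF V (br_mem_lieGen hA hB),
    Ring.lie_def, brTensor, map_sub, map_mul, map_mul]

/-- `A ↦ (Ad_{e^{sX}} V_A)(m)` as a linear map on the free Lie algebra. -/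
def adFlowL (V : DynSys E M d) (X : SmoothVF E M) (s : ℝ) (m : M) : freeLie d →ₗ[ℝ] E where
  toFun A := adFlow X s (extVF V A) m
  map_add' A B := (congrArg (fun Y => (adFlow X s Y m : E)) (extVF_add V A.2 B.2)).trans
    (adFlow_add_right X _ _ s m)
  map_smul' c A := (congrArg (fun Y => (adFlow X s Y m : E)) (extVF_smul V c A.2)).trans
    (adFlow_smul_right X c _ s m)

theorem adFlowL_sum (V : DynSys E M d) (X : SmoothVF E M) (s : ℝ) (m : M) {ι : Type*}
    (S : Finset ι) (c : ι → ℝ) {P : ι → Tens d} (hP : ∀ i, P i ∈ freeLie d) :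
    (adFlow X s (extVF V (∑ i ∈ S, c i • P i)) m : E) =
      ∑ i ∈ S, c i • (adFlow X s (extVF V (P i)) m : E) := by
  have h := map_sum (adFlowL V X s m) (fun i => c i • (⟨P i, hP i⟩ : freeLie d)) S
  simp only [map_smul] at h
  refine Eq.trans ?_ h
  change _ = adFlow X s (extVF V ((∑ i ∈ S, c i • (⟨P i, hP i⟩ : freeLie d) : freeLie d) :
    Tens d)) m
  congr 2
  simp

/-- The identity `∫₀¹ Ad_{e^{sV_A}} V_B ds = V_{ψ(-ad_A) B} + remainder` comes from the fundamental
theorem of calculus, applied to `s ↦ Ad_{e^{sV_A}} V_{C(s)}` with `C(s) = (s-1) ψ((s-1) ad_A) B`. -/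
theorem vfIntegral_adFlow_eq (hκ : 1 ≤ κ) (V : DynSys E M d) {A B : Tens d}
    (hX : IsCompleteVF (extVF V A)) (hA : A ∈ freeNil d κ) (hB : B ∈ freeNil d κ) :
    VFIntegrable (fun s => adFlow (extVF V A) s (extVF V B)) ∧
    VFIntegrable (fun s m => (s - 1) • adFlow (extVF V A) s
      (extVF V (truncAbove κ (brTensor A (nilpEval κ psi ((s - 1) • truncAd κ A) B)))) m) ∧
    vfIntegral (fun s => adFlow (extVF V A) s (extVF V B)) =
      (fun m => extVF V (nilpEval κ psi (-truncAd κ A) B) m) +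
        vfIntegral (fun s m => (s - 1) • adFlow (extVF V A) s
          (extVF V (truncAbove κ
            (brTensor A (nilpEval κ psi ((s - 1) • truncAd κ A) B)))) m) := by
  have hle := freeNil_le_freeLie (d := d) κ
  set X := extVF V A with hXdef
  let P : ℕ → Tens d := fun k => (truncAd κ A ^ k) B
  have hP : ∀ k, P k ∈ freeLie d := fun k => hle (truncAd_pow_mem_freeNil hA hB k)
  let R : ℕ → Tens d := fun k => truncAbove κ (brTensor A (P k))
  have hbr : ∀ k, brTensor A (P k) ∈ freeLie d := fun k => br_mem_lieGen (hle hA) (hP k)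
  have hR : ∀ k, R k ∈ freeLie d := fun k => truncAbove_mem_freeLie (hbr k) κ
  have hsplit : ∀ k, brTensor A (P k) = P (k + 1) + R k := by
    intro k
    have h1 : P (k + 1) = trunc κ (brTensor A (P k)) := by
      change (truncAd κ A ^ (k + 1)) B = _
      rw [pow_succ', Module.End.mul_apply]
      rfl
    rw [h1]
    change _ = _ + (brTensor A (P k) - trunc κ (brTensor A (P k)))
    abel
  let a : M → ℕ → ℝ → E := fun m k s => adFlow X s (extVF V (P k)) m
  let b : M → ℕ → ℝ → E := fun m k s => adFlow X s (extVF V (R k)) m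
  have ha : ∀ m k s, HasDerivAt (a m k) (-(a m (k + 1) s + b m k s)) s := by
    intro m k s
    refine (hasDerivAt_adFlow hX (extVF V (P k)) m s).congr_deriv ?_
    rw [hXdef, vfBracket_extVF V (hle hA) (hP k), hsplit, extVF_add V (hP _) (hR _)]
    exact congrArg Neg.neg (adFlow_add_right _ _ _ s m)
  have hac : ∀ m k, Continuous (a m k) := fun m k =>
    continuous_iff_continuousAt.2 fun s => (ha m k s).continuousAt
  have hbc : ∀ m k, Continuous (b m k) := fun m k =>
    continuous_iff_continuousAt.2 fun s => (hasDerivAt_adFlow hX (extVF V (R k)) m s).continuousAt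
  have haκ : ∀ m s, a m κ s = 0 := by
    intro m s
    have h0 : P κ = 0 := truncAd_pow_eq_zero hκ le_rfl hA hB
    exact (congrArg (fun C => (adFlow X s (extVF V C) m : E)) h0).trans
      (map_zero (adFlowL V X s m))
  have hsum : ∀ m s, (adFlow X s (extVF V (truncAbove κ
      (brTensor A (nilpEval κ psi ((s - 1) • truncAd κ A) B)))) m : E) =
      ∑ k ∈ Finset.range κ, ((s - 1) ^ k * ((k + 1).factorial : ℝ)⁻¹) • b m k s := by
    intro m s
    have h1 : truncAbove κ (brTensor A (nilpEval κ psi ((s - 1) • truncAd κ A) B)) =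
        ∑ k ∈ Finset.range κ, ((s - 1) ^ k * ((k + 1).factorial : ℝ)⁻¹) • R k := by
      change (truncAbove κ ∘ₗ (LinearMap.mulLeft ℝ A - LinearMap.mulRight ℝ A)) _ = _
      rw [nilpEval_psi_apply, map_sum]
      simp only [map_smul]
      rfl
    rw [h1]
    exact adFlowL_sum V X s m _ _ hR
  have hint1 : ∀ m, IntervalIntegrable (a m 0) MeasureTheory.volume 0 1 := fun m =>
    (hac m 0).intervalIntegrable _ _
  let g : M → ℝ → E := fun m s => (s - 1) •
    ∑ k ∈ Finset.range κ, ((s - 1) ^ k * ((k + 1).factorial : ℝ)⁻¹) • b m k s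
  have hgc : ∀ m, Continuous (g m) := fun m =>
    (continuous_id.sub continuous_const).smul (continuous_finsetSum _ fun k _ =>
      (((continuous_id.sub continuous_const).pow k).mul continuous_const).smul (hbc m k))
  have hg : ∀ m, (fun s => ((s - 1) • adFlow X s (extVF V (truncAbove κ
      (brTensor A (nilpEval κ psi ((s - 1) • truncAd κ A) B)))) m : E)) = g m :=
    fun m => funext fun s => congrArg (fun w : E => (s - 1) • w) (hsum m s)
  -- `u` is the curve `Ad_{e^{sX}} V_{C(s)}` at `m`
  let u : M → ℝ → E := fun m s =>
    ∑ k ∈ Finset.range κ, ((s - 1) ^ (k + 1) * ((k + 1).factorial : ℝ)⁻¹) • a m k s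
  have hu : ∀ m s, HasDerivAt (u m) (a m 0 s - g m s) s := by
    intro m s
    have hterm : ∀ k : ℕ, HasDerivAt
        (fun s => ((s - 1) ^ (k + 1) * ((k + 1).factorial : ℝ)⁻¹) • a m k s)
        (((s - 1) ^ (k + 1) * ((k + 1).factorial : ℝ)⁻¹) • (-(a m (k + 1) s + b m k s)) +
          ((s - 1) ^ k * (k.factorial : ℝ)⁻¹) • a m k s) s := by
      intro k
      have h1 : HasDerivAt (fun s : ℝ => (s - 1) ^ (k + 1) * ((k + 1).factorial : ℝ)⁻¹)
          ((s - 1) ^ k * (k.factorial : ℝ)⁻¹) s := by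
        have h2 := (((hasDerivAt_id s).sub_const 1).pow (k + 1)).mul_const
          ((k + 1).factorial : ℝ)⁻¹
        refine h2.congr_deriv ?_
        rw [Nat.factorial_succ]
        push_cast
        have h3 : (k.factorial : ℝ) ≠ 0 := by positivity
        have h4 : (k : ℝ) + 1 ≠ 0 := by positivity
        field_simp
        simp
      exact h1.smul (ha m k s)
    refine (HasDerivAt.fun_sum fun k _ => hterm k).congr_deriv ?_
    -- apart from the terms with `b`, the sum telescopes
    have htel := Finset.sum_range_sub
      (fun k => ((s - 1) ^ k * (k.factorial : ℝ)⁻¹) • a m k s) κ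
    rw [haκ m s, smul_zero] at htel
    have h5 : ∀ k, ((s - 1) ^ (k + 1) * ((k + 1).factorial : ℝ)⁻¹) •
        (-(a m (k + 1) s + b m k s)) + ((s - 1) ^ k * (k.factorial : ℝ)⁻¹) • a m k s =
        -(((s - 1) ^ (k + 1) * ((k + 1).factorial : ℝ)⁻¹) • a m (k + 1) s -
          ((s - 1) ^ k * (k.factorial : ℝ)⁻¹) • a m k s) -
        (s - 1) • ((s - 1) ^ k * ((k + 1).factorial : ℝ)⁻¹) • b m k s := by
      intro k
      rw [smul_neg, smul_add, smul_smul, pow_succ' (s - 1) k, mul_assoc]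
      abel
    rw [Finset.sum_congr rfl fun k _ => h5 k, Finset.sum_sub_distrib, Finset.sum_neg_distrib, htel,
      ← Finset.smul_sum]
    simp [g]
  have hu1 : ∀ m, u m 1 = 0 := fun m => Finset.sum_eq_zero fun k _ => by simp
  let w : M → E := fun m => extVF V (nilpEval κ psi (-truncAd κ A) B) m
  have hu0 : ∀ m, u m 0 = -w m := by
    intro m
    have h1 : w m = ∑ k ∈ Finset.range κ,
        ((-1 : ℝ) ^ k * ((k + 1).factorial : ℝ)⁻¹) • a m k 0 := by
      change (extVF V (nilpEval κ psi (-truncAd κ A) B) m : E) = _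
      rw [← neg_one_smul ℝ (truncAd κ A), nilpEval_psi_apply]
      exact (adFlow_zero hX _ m).symm.trans (adFlowL_sum V X 0 m _ _ hP)
    rw [h1, ← Finset.sum_neg_distrib]
    refine Finset.sum_congr rfl fun k _ => ?_
    rw [← neg_smul, pow_succ, zero_sub]
    congr 1
    ring
  refine ⟨hint1, fun m => ?_, ?_⟩
  · have h := (hgc m).intervalIntegrable (μ := MeasureTheory.volume) 0 1
    rw [← hg m] at h
    exact h
  · funext m
    have hFTC := intervalIntegral.integral_eq_sub_of_hasDerivAt (a := 0) (b := 1)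
      (fun s _ => hu m s) (((hac m 0).sub (hgc m)).intervalIntegrable _ _)
    rw [intervalIntegral.integral_sub (hint1 m) ((hgc m).intervalIntegrable _ _), hu1, hu0,
      zero_sub, neg_neg, sub_eq_iff_eq_add] at hFTC
    refine hFTC.trans ?_
    rw [← hg m]
    rfl

end Extension
end FlowLog

end

open FlowLog

theorem theorem4p1
    {E : Type*} [NormedAddCommGroup E] [NormedSpace ℝ E] [FiniteDimensional ℝ E]
    {M : Type*} [TopologicalSpace M] [T2Space M] [ChartedSpace E M] [IsManifold 𝓘(ℝ, E) ∞ M]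
    {d κ : ℕ} (hκ : 1 ≤ κ) {T : ℝ} (hT : 0 < T)
    (V : DynSys E M d) (hV : IsKappaComplete κ T V) :
    -- each `V_A` is complete, so that the flows `e^{sV_A}` are defined
    (∀ A ∈ freeNil d κ, IsCompleteVF (extVF V A)) ∧
    ∀ A ∈ freeNil d κ, ∀ B ∈ freeNil d κ,
      -- both integrals over `M` exist
      VFIntegrable (fun s => adFlow (extVF V A) s (extVF V B)) ∧
      VFIntegrable (fun s m => (s - 1) • adFlow (extVF V A) s
        (extVF V (truncAbove κ (brTensor A (nilpEval κ psi ((s - 1) • truncAd κ A) B)))) m) ∧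
      -- the identity with `J = ∫₀¹ Ad_{e^{-sA}} B ds`
      (∃ J ∈ freeNil d κ, HasIntegral01 (fun s : ℝ => truncAdExp κ ((-s) • A) B) J ∧
        vfIntegral (fun s => adFlow (extVF V A) s (extVF V B)) =
          (fun m => extVF V J m) + vfIntegral (fun s m => (s - 1) • adFlow (extVF V A) s
            (extVF V (truncAbove κ
              (brTensor A (nilpEval κ psi ((s - 1) • truncAd κ A) B)))) m)) ∧
      -- the identity with `ψ(-ad_A) B`
      vfIntegral (fun s => adFlow (extVF V A) s (extVF V B)) =
        (fun m => extVF V (nilpEval κ psi (-truncAd κ A) B) m) +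
          vfIntegral (fun s m => (s - 1) • adFlow (extVF V A) s
            (extVF V (truncAbove κ
              (brTensor A (nilpEval κ psi ((s - 1) • truncAd κ A) B)))) m) := by
  have : CompleteSpace E := FiniteDimensional.complete ℝ E
  have hcomplete : ∀ A ∈ freeNil d κ, IsCompleteVF (extVF V A) :=
    fun A hA => hV.isCompleteVF hT hA
  refine ⟨hcomplete, fun A hA B hB => ?_⟩
  obtain ⟨h1, h2, h3⟩ := vfIntegral_adFlow_eq hκ V (hcomplete A hA) hA hB
  refine ⟨h1, h2, ⟨nilpEval κ psi (-truncAd κ A) B, ?_, hasIntegral01_truncAdExp hκ hA hB, h3⟩, h3⟩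
  rw [← neg_one_smul ℝ (truncAd κ A)]
  exact nilpEval_mem_freeNil κ psi (-1) hA hB
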